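/- **Model.** Let $T$ be a tree with $n$ anonymous nodes and diameter $D$; at each node of degree $\delta$ the incident edges carry distinct port numbers $0,\dots,\delta-1$ (the two port numbers of an edge are unrelated). $n$ robots with distinct labels in $[1,n^c]$, where $c\ge 1$ is a constant, all start at one node, the root. Time proceeds in synchronous rounds. In each round a robot first communicates with the robots at its node and computes locally, knowing the degree of the node and, if it has just moved, the port through which it entered; then it stays or leaves through a port. The memory of a robot bounds both what it stores and the space of its local computations: a robot with $b$ bits has at most $2^b$ memory states, and in an elementary step of a local computation it receives the message of one co-located robot and changes its memory state. *Dispersion* means that exactly one robot is present on each node. **Algorithm Rooted-Tree-LogN.** Every robot is in state *root*, *explore*, *wait* or *settled*. Initially the robot with the lowest label becomes *root*, assigned to the root of the tree, and all others *explore*; if $n=1$ the root robot stops at once. Stage $L=1,2,\dots$ has rounds $1,\dots,2L+1$. * An exploring robot at a node without an assigned robot settles there: it stores the entry port as parent pointer and sets its number of required robots to $\delta-1$. Otherwise, in rounds $r<L$, the exploring robots at the node are assigned, in order of increasing labels, to the ports other than the parent port in increasing order, each port taking as many robots as the child that is visiting through this port requires (one robot per port if no child is visiting), and they move through these ports; robots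 that are not assigned a port, and all those in round $r=L$, wait until the next stage. * A settled robot at distance $d$ from the root that has not stopped goes to its parent node in rounds $d-1$ and $2L-d$ (and, if $d=1$ and its subtree is not known to be fully dispersed, in round $2L+1$). At the parent node, in rounds $d$ and $2L-d+1$, it tells the robots there its number of required robots, its entry port and whether its subtree is fully dispersed, and it returns. * A settled robot that is visited by children replaces its number of required robots by the sum of theirs and adds the number of fully dispersed subtrees reported to a counter. When it goes up in round $2L-d$, after taking in these messages, it declares its own subtree fully dispersed if the counter equals $\delta-1$; the root robot counts the fully dispersed robots that enter and declares the same when its counter equals $\delta$. * A robot whose subtree is declared fully dispersed stops at the end of the stage. **Theorem.** The algorithm Rooted-Tree-LogN can be run by robots with $O(\log n)$ bits of memory each (in particular, with $O(\Delta+\log n)$ bits, where $\Delta$ is the maximum degree), where the constant depends only on $c$ and the robots may depend on $n$ and $c$ but not otherwise on the tree, and it achieves dispersion in $O(D^2)$ rounds on all rooted trees: there is an absolute constant $A$ such that at all times after $A D^2$ rounds, exactly one robot is present on each node and all robots have stopped. -/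

import Mathlib

universe u

/-! ### The model: anonymous port-numbered graphs and synchronous mobile robots -/

/-- A port numbering: at every node `v` of degree `δ` the incident edges carry the distinct port
numbers `0, …, δ - 1`. The two port numbers of an edge are unrelated. -/
abbrev PortNumbering {V : Type*} (G : SimpleGraph V) [G.LocallyFinite] : Type _ :=
  ∀ v : V, G.neighborSet v ≃ Fin (G.degree v)

/-- Leaving `v` through port `p`: the node that is reached, and the port through which it is
entered (`none` if `v` has no port `p`). -/
def PortNumbering.cross {V : Type*} {G : SimpleGraph V} [G.LocallyFinite]
    (P : PortNumbering G) (v : V) (p : ℕ) : Option (V × ℕ) :=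
  if h : p < G.degree v then
    some (((P v).symm ⟨p, h⟩ : V),
      (P ((P v).symm ⟨p, h⟩) ⟨v, ((P v).symm ⟨p, h⟩).2.symm⟩ : ℕ))
  else none

/-- What a robot with memory content in `M` has at its disposal in the first step of a round. -/
structure Obs (M : Type*) where
  /-- the robot's own memory -/
  me : M
  /-- the degree of the current node -/
  deg : ℕ
  /-- the port through which the robot entered the node in the preceding round, if it moved -/
  arr : Option ℕ
  /-- memory and arrival port of all robots at the node, the robot itself included -/
  here : Multiset (M × Option ℕ)

/-- A deterministic algorithm, run by every robot. -/
structure RobotAlgorithm (M : Type*) where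
  /-- the initial memory of the robot with a given label -/
  fresh : ℕ → M
  /-- initialisation: local communication and computation before the first round's loop body -/
  setup : Obs M → M
  /-- one round: the new memory, and the port to leave through (`none`: stay) -/
  act : Obs M → M × Option ℕ

/-- A configuration of `n` robots. -/
structure Config (n : ℕ) (V M : Type*) where
  pos : Fin n → V
  mem : Fin n → M
  arr : Fin n → Option ℕ

section Execution

variable {V M : Type*} [DecidableEq V] {G : SimpleGraph V} [G.LocallyFinite] {n : ℕ}

/-- What robot `i` observes. -/
def Config.obs (G : SimpleGraph V) [G.LocallyFinite] (C : Config n V M) (i : Fin n) : Obs M where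
  me := C.mem i
  deg := G.degree (C.pos i)
  arr := C.arr i
  here := ({j | C.pos j = C.pos i} : Finset (Fin n)).val.map fun j => (C.mem j, C.arr j)

/-- All robots are at the node `r`; the only thing that distinguishes them is the label. -/
def RobotAlgorithm.freshConfig (alg : RobotAlgorithm M) (r : V) (lab : Fin n → ℕ) :
    Config n V M where
  pos _ := r
  mem i := alg.fresh (lab i)
  arr _ := none

/-- One synchronous round. -/
def RobotAlgorithm.round (alg : RobotAlgorithm M) (P : PortNumbering G) (C : Config n V M) :
    Config n V M :=
  let out (i : Fin n) : M × Option ℕ := alg.act (C.obs G i)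
  let dest (i : Fin n) : Option (V × ℕ) := (out i).2.bind fun p => P.cross (C.pos i) p
  { pos := fun i => ((dest i).map Prod.fst).getD (C.pos i)
    mem := fun i => (out i).1
    arr := fun i => (dest i).map Prod.snd }

/-- The configuration after `t` rounds, if all robots start at `r`. -/
def RobotAlgorithm.run (alg : RobotAlgorithm M) (P : PortNumbering G) (r : V)
    (lab : Fin n → ℕ) : ℕ → Config n V M
  | 0 =>
    let C := alg.freshConfig r lab
    { C with mem := fun i => alg.setup (C.obs G i) }
  | t + 1 => alg.round P (alg.run P r lab t)

/-- Exactly one robot is present on each node. -/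
def Config.Dispersed (C : Config n V M) : Prop := ∀ v : V, ∃! i : Fin n, C.pos i = v

end Execution

/-! ### Robots with bounded memory

The memory of a robot bounds the information that it stores between rounds as well as its local
computations: whatever it does, it is in one of `2 ^ b` memory states. -/

/-- A robot with set `W` of memory states. A local computation proceeds in elementary steps. In
each of them the robot addresses the co-located robot with label `ask w` (if there is one), whose
reply is its memory state at the beginning of the round together with its arrival port; with this
reply, the degree of the node and its own arrival port, the robot either changes its memory state
(`Sum.inl`) or finishes the local computation with a memory state and a move (`Sum.inr`). -/
structure MemoryRobot (W : Type*) where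
  ask : W → ℕ
  next : W → ℕ → Option ℕ → Option (W × Option ℕ) → W ⊕ (W × Option ℕ)

/-- `K.Computes deg arr reply w out`: started in the memory state `w`, the local computation
terminates with the outcome `out`. -/
inductive MemoryRobot.Computes {W : Type*} (K : MemoryRobot W) (deg : ℕ) (arr : Option ℕ)
    (reply : ℕ → Option (W × Option ℕ)) : W → W × Option ℕ → Prop
  | finish {w : W} {out : W × Option ℕ} (h : K.next w deg arr (reply (K.ask w)) = Sum.inr out) :
      Computes K deg arr reply w out
  | step {w w' : W} {out : W × Option ℕ} (h : K.next w deg arr (reply (K.ask w)) = Sum.inl w')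
      (h' : Computes K deg arr reply w' out) : Computes K deg arr reply w out

/-- The reply that robot `i` gets when it addresses the label `q`, if a memory content `x` is
stored as the memory state `enc x`. -/
def Config.reply {n : ℕ} {V M W : Type*} [DecidableEq V] (C : Config n V M) (lab : Fin n → ℕ)
    (enc : M → W) (i : Fin n) (q : ℕ) : Option (W × Option ℕ) :=
  ((List.finRange n).find? fun j => decide (C.pos j = C.pos i ∧ lab j = q)).map
    fun j => (enc (C.mem j), C.arr j)

/-- In the configuration `C`, the local computation of robot `i` according to `f` is carried out
by the robot `K`. -/
def MemoryRobot.Realizes {n : ℕ} {V M W : Type*} [DecidableEq V] (G : SimpleGraph V)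
    [G.LocallyFinite] (K : MemoryRobot W) (enc : M → W) (lab : Fin n → ℕ) (C : Config n V M)
    (i : Fin n) (f : Obs M → M × Option ℕ) : Prop :=
  K.Computes (G.degree (C.pos i)) (C.arr i) (C.reply lab enc i) (enc (C.mem i))
    (enc (f (C.obs G i)).1, (f (C.obs G i)).2)

/-- On all rooted trees with `n` nodes, for all port numberings and all distinct labels of the `n`
robots in `[1, N]`, the algorithm can be run by robots with `b` bits of memory (which are the same
for all these trees): they perform the initialisation and every round. -/
def RobotAlgorithm.RunsWithBits {M : Type} (alg : RobotAlgorithm M) (n N b : ℕ) : Prop :=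
  ∃ (W : Type) (_ : Fintype W) (K : MemoryRobot W) (enc : M → W), Fintype.card W ≤ 2 ^ b ∧
    ∀ (V : Type u) [Fintype V] [DecidableEq V] (G : SimpleGraph V) [DecidableRel G.Adj],
      G.IsTree → Fintype.card V = n →
      ∀ (P : PortNumbering G) (r : V) (lab : Fin n → ℕ), Function.Injective lab →
        (∀ i, 1 ≤ lab i ∧ lab i ≤ N) →
        (∀ i, K.Realizes G enc lab (alg.freshConfig r lab) i fun o => (alg.setup o, none)) ∧
        ∀ t i, K.Realizes G enc lab (alg.run P r lab t) i alg.act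

/-! ### The algorithm Rooted-Tree-LogN -/

/-- The four states of a robot. -/
inductive RobotState
  | root
  | explore
  | wait
  | settled
  deriving DecidableEq

/-- The memory of a robot: its label, the nine variables, and `stopped`, which records that it has
left the main loop. -/
structure Mem where
  label : ℕ
  portEntered : ℕ
  parentPtr : Option ℕ
  state : RobotState
  distFromRoot : ℕ
  fullyDispersedPort : ℕ
  fullyDispersed : Bool
  numRobotsReqd : ℕ
  lvlCntr : ℕ
  rndCntr : ℕ
  stopped : Bool

/-- The rounds of a stage in which a settled robot leaves its node for the parent node. -/
abbrev Mem.GoesUp (x : Mem) : Prop :=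
  x.rndCntr + 1 = x.distFromRoot ∨ x.rndCntr + x.distFromRoot = 2 * x.lvlCntr ∨
    (x.distFromRoot = 1 ∧ x.rndCntr = 2 * x.lvlCntr + 1 ∧ x.fullyDispersed = false)

/-- The rounds of a stage in which a settled robot is at the parent node. -/
abbrev Mem.AtParent (x : Mem) : Prop :=
  ¬ x.GoesUp ∧
    (x.rndCntr = x.distFromRoot ∨ x.rndCntr + x.distFromRoot = 2 * x.lvlCntr + 1)

/-- The robot is settled, is visiting the parent node and communicates its values there. -/
abbrev Mem.Informs (x : Mem) : Prop :=
  x.stopped = false ∧ x.state = RobotState.settled ∧ x.AtParent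

/-- The robot is assigned to the node at which it is. -/
abbrev Mem.AtHome (x : Mem) : Prop :=
  x.state = RobotState.root ∨ (x.state = RobotState.settled ∧ ¬ x.Informs)

/-- The co-located robots that communicate their values, with their arrival ports. -/
def Obs.informers (o : Obs Mem) : Multiset (Mem × Option ℕ) := o.here.filter fun z => z.1.Informs

/-- How many exploring robots go through port `p`: none through the parent port, and otherwise the
number that the visiting child asks for or, if no child is visiting, one. (If children are visiting,
the fully dispersed ports are those without a visitor; no robot is sent there.) -/
def Obs.need (o : Obs Mem) (p : ℕ) : ℕ :=
  if 0 < o.here.countP (fun z => z.1.AtHome ∧ z.1.parentPtr = some p) then 0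
  else if o.informers.card = 0 then 1
  else ((o.informers.filter fun z => z.2 = some p).map fun z => z.1.numRobotsReqd).sum

/-- The position of the robot in the order of increasing labels of the exploring robots. -/
def Obs.rank (o : Obs Mem) : ℕ :=
  o.here.countP fun z => z.1.state = RobotState.explore ∧ z.1.label < o.me.label

/-- The port to which the robot is assigned, if any: the ports are filled in increasing order, with
the exploring robots in the order of increasing labels. -/
def Obs.assignedPort (o : Obs Mem) : Option ℕ :=
  ((List.range o.deg).flatMap fun p => List.replicate (o.need p) p)[o.rank]?

/-- Procedure Further-Explore, for a robot with memory `x`. -/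
def Obs.furtherExplore (o : Obs Mem) (x : Mem) : Mem × Option ℕ :=
  match o.assignedPort with
  | some p => ({ x with distFromRoot := x.distFromRoot + 1 }, some p)
  | none => ({ x with state := RobotState.wait }, none)

/-- A settled robot at its node takes in what the robots settled at the children communicate. -/
def Obs.hear (o : Obs Mem) : Mem :=
  { o.me with
    fullyDispersedPort :=
      o.me.fullyDispersedPort + o.informers.countP fun z => z.1.fullyDispersed = true
    numRobotsReqd :=
      if o.informers.card = 0 then o.me.numRobotsReqd
      else (o.informers.map fun z => z.1.numRobotsReqd).sum }

/-- The body of the loop over the rounds of a stage. -/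
def Obs.body (o : Obs Mem) : Mem × Option ℕ :=
  match o.me.state with
  | RobotState.root =>
    let k := o.me.fullyDispersedPort +
      o.here.countP fun z => z.2 ≠ none ∧ z.1.fullyDispersed = true
    ({ o.me with
        fullyDispersedPort := k
        fullyDispersed := o.me.fullyDispersed || decide (k = o.deg) }, none)
  | RobotState.explore =>
    let x : Mem := { o.me with portEntered := o.arr.getD o.me.portEntered }
    if 0 < o.here.countP (fun z => z.1.AtHome) then
      if x.rndCntr < x.lvlCntr then o.furtherExplore x
      else ({ x with state := RobotState.wait }, none)
    else
      ({ x with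
          state := RobotState.settled
          numRobotsReqd := o.deg - 1
          parentPtr := some x.portEntered }, none)
  | RobotState.wait =>
    (if o.me.rndCntr = 2 * o.me.lvlCntr + 1 then { o.me with state := RobotState.explore }
      else o.me, none)
  | RobotState.settled =>
    if o.me.GoesUp then
      ({ o.hear with
          fullyDispersed :=
            o.me.fullyDispersed || decide (o.hear.fullyDispersedPort + 1 = o.deg) },
        o.me.parentPtr)
    else if o.me.AtParent then
      let q := o.arr.getD o.me.portEntered
      ({ o.me with portEntered := q }, some q)
    else (o.hear, none)

/-- Control of the loops: stage `lvlCntr` consists of `2 * lvlCntr + 1` rounds, and stages are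
executed while `fullyDispersed` is false. -/
def Mem.tick (x : Mem) : Mem :=
  if x.rndCntr = 2 * x.lvlCntr + 1 then
    if x.fullyDispersed then { x with stopped := true }
    else { x with lvlCntr := x.lvlCntr + 1, rndCntr := 1 }
  else { x with rndCntr := x.rndCntr + 1 }

/-- The algorithm Rooted-Tree-LogN. In the initialisation, the robot with the lowest label is
assigned to the root and stage 1 begins; if the root is the only node, that robot is done. -/
def rootedTreeLogN : RobotAlgorithm Mem where
  fresh ℓ :=
    { label := ℓ
      portEntered := 0
      parentPtr := none
      state := RobotState.explore
      distFromRoot := 0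
      fullyDispersedPort := 0
      fullyDispersed := false
      numRobotsReqd := 0
      lvlCntr := 0
      rndCntr := 0
      stopped := false }
  setup o :=
    let x : Mem := { o.me with lvlCntr := 1, rndCntr := 1 }
    if ∀ z ∈ o.here, o.me.label ≤ z.1.label then
      { x with
        state := RobotState.root
        numRobotsReqd := o.deg
        fullyDispersed := decide (o.deg = 0)
        stopped := decide (o.deg = 0) }
    else x
  act o := if o.me.stopped then (o.me, none) else (o.body.1.tick, o.body.2)

/-! Every number that settled robots exchange is a value of `levelCard G r v k`, the number of
descendants of `v` at depth `k`, set to 1 when `v` itself has depth at least `k`. After stage `L`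
the assigned nodes are those of depth less than `L`. To fill depth `L - 1`, the subtree of `v` needs
`levelCard G r v (L - 1)` robots, and it is full after stage `L` iff `levelCard G r v L = 0`. The
recursion `levelCard_eq_sum` is exactly the addition of the children's messages, and empty levels
stay empty (`levelCard_eq_zero_of_le`), so a robot that has stopped is never needed again.

`StageInv` describes the configuration at the start of each round. On the way up, a node at depth
`d` hears in round `2L - d` the values of its children for level `L`; `knownStage` records whether
this has happened. On the way down, the moving explorers are at depth `k - 1` in round `k`, where
they meet the running children of their node, or no children at all at depth `L - 2`. In both cases
the port towards a child `w` asks for `levelCard G r w (L - 1)` robots (`StageInv.need_child`).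
Distributing robots by label rank realizes these numbers exactly (`card_filter_getElem?_rank`); the
root has enough robots because the unassigned ones are at least as many as the nodes at depth `L -
1`, and its surplus waits there. In round `L` each node at depth `L - 1` thus holds exactly one
explorer, which becomes its owner (`StageInv.step_settle`).

Stages `1, …, L` last `(L + 1)² - 1` rounds. The last stage is the first `H` for which level `H` of
the tree is empty, so `H ≤ D + 1`, and `(D + 2)² - 1 ≤ 8 D²` for `D ≥ 1`. From then on all owners
have stopped at their nodes, and `n` owners of `n` nodes are all the robots.

For the memory bound, a robot needs from its neighbours only nine sums (`Obs.sums`). It obtains them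
by addressing all labels in turn, repeating this for each port while carrying the prefix sum of the
port requirements, and stops at the first port whose prefix sum exceeds its rank; no list is ever
stored. All intermediate numbers are polynomial in `n`, so boundedly many numbers of `O(log n)` bits
suffice (`sweep_ports`, `card_code_le`). -/

set_option linter.unusedSectionVars false

/-! ### Rooted trees: parents, children, level counts, ports. -/

section Tree

variable {V : Type*} [Fintype V] [DecidableEq V] (G : SimpleGraph V) [DecidableRel G.Adj]

/-- The children of `u` in the tree `G` rooted at `r`. -/
noncomputable def children (r u : V) : Finset V :=
  {w | G.Adj u w ∧ G.dist r w = G.dist r u + 1}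

open Classical in
/-- The parent of `v` in the tree `G` rooted at `r` (`v` itself at the root). -/
noncomputable def parent (r v : V) : V :=
  if h : ∃ u, v ∈ children G r u then h.choose else v

/-- The number of descendants of `v` that are `j` levels below `v`. -/
noncomputable def numBelow (r : V) : ℕ → V → ℕ
  | 0, _ => 1
  | j + 1, v => ∑ w ∈ children G r v, numBelow r j w

/-- The number of descendants of `v` at depth `k`, and `1` if `v` is at least that deep. -/
noncomputable def levelCard (r v : V) (k : ℕ) : ℕ := numBelow G r (k - G.dist r v) v

/-- The port of `v` towards its neighbour `w`. -/
def PortNumbering.port {V : Type*} {G : SimpleGraph V} [G.LocallyFinite] [DecidableRel G.Adj]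
    (P : PortNumbering G) (v w : V) : ℕ :=
  if h : G.Adj v w then P v ⟨w, h⟩ else 0

variable {G} {r : V}

theorem mem_children {u w : V} :
    w ∈ children G r u ↔ G.Adj u w ∧ G.dist r w = G.dist r u + 1 := by
  simp [children]

/-- The vertex before `v` on a geodesic from `r` works, since distances to `r` of adjacent vertices
of a tree differ by exactly one. -/
theorem mem_children_parent (hG : G.IsTree) {v : V} (hv : v ≠ r) :
    v ∈ children G r (parent G r v) := by
  have h : ∃ u, v ∈ children G r u := by
    obtain ⟨p, hp⟩ := hG.connected.exists_walk_length_eq_dist r v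
    have hnil : ¬ p.Nil := fun h => hv (h.eq).symm
    have hadj := p.adj_penultimate hnil
    refine ⟨p.penultimate, mem_children.2 ⟨hadj, ?_⟩⟩
    have h1 : G.dist r p.penultimate ≤ p.length - 1 := by
      have := SimpleGraph.dist_le p.dropLast
      simpa using this
    have h2 := hG.dist_eq_dist_add_one_of_adj r hadj
    omega
  rw [parent, dif_pos h]
  exact h.choose_spec

theorem ne_root_of_mem_children {u w : V} (h : w ∈ children G r u) : w ≠ r := by
  rintro rfl
  have := (mem_children.1 h).2
  simp at this

/-- Geodesics from `r` to `u` and to `u'`, extended by the edge to `v`, are again geodesics, hence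
paths; uniqueness of paths identifies their penultimate vertices. -/
theorem eq_of_mem_children (hG : G.IsTree) {u u' v : V} (h : v ∈ children G r u)
    (h' : v ∈ children G r u') : u = u' := by
  rw [mem_children] at h h'
  obtain ⟨p, hp⟩ := hG.connected.exists_walk_length_eq_dist r u
  obtain ⟨q, hq⟩ := hG.connected.exists_walk_length_eq_dist r u'
  have h1 : (p.concat h.1).IsPath :=
    SimpleGraph.Walk.isPath_of_length_eq_dist _ (by simp [hp, h.2])
  have h2 : (q.concat h'.1).IsPath :=
    SimpleGraph.Walk.isPath_of_length_eq_dist _ (by simp [hq, h'.2])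
  have := (hG.isAcyclic.subsingleton_path r v).elim ⟨_, h1⟩ ⟨_, h2⟩
  have h3 := congrArg (fun z : G.Path r v => (z : G.Walk r v).penultimate) this
  simpa using h3

theorem parent_eq (hG : G.IsTree) {u v : V} (h : v ∈ children G r u) : parent G r v = u :=
  eq_of_mem_children hG (mem_children_parent hG (ne_root_of_mem_children h)) h

theorem parent_adj (hG : G.IsTree) {v : V} (hv : v ≠ r) : G.Adj (parent G r v) v :=
  (mem_children.1 (mem_children_parent hG hv)).1

theorem dist_parent (hG : G.IsTree) {v : V} (hv : v ≠ r) :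
    G.dist r v = G.dist r (parent G r v) + 1 :=
  (mem_children.1 (mem_children_parent hG hv)).2

theorem adj_cases (hG : G.IsTree) {u w : V} (h : G.Adj u w) :
    w ∈ children G r u ∨ (u ≠ r ∧ w = parent G r u) := by
  rcases hG.dist_eq_dist_add_one_of_adj r h with h1 | h1
  · have hm : u ∈ children G r w := mem_children.2 ⟨h.symm, h1⟩
    exact Or.inr ⟨ne_root_of_mem_children hm, (parent_eq hG hm).symm⟩
  · exact Or.inl (mem_children.2 ⟨h, h1⟩)

theorem parent_notMem_children (hG : G.IsTree) {v : V} (hv : v ≠ r) :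
    parent G r v ∉ children G r v := by
  intro h
  have h1 := (mem_children.1 h).2
  have h2 := dist_parent hG hv
  omega

theorem degree_root (hG : G.IsTree) : G.degree r = (children G r r).card := by
  rw [← SimpleGraph.card_neighborFinset_eq_degree]
  congr 1
  ext w
  rw [SimpleGraph.mem_neighborFinset]
  constructor
  · intro h
    rcases adj_cases (r := r) hG h with h | h
    · exact h
    · exact absurd rfl h.1
  · exact fun h => (mem_children.1 h).1

theorem degree_of_ne (hG : G.IsTree) {v : V} (hv : v ≠ r) :
    G.degree v = (children G r v).card + 1 := by
  rw [← SimpleGraph.card_neighborFinset_eq_degree,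
    ← Finset.card_insert_of_notMem (parent_notMem_children hG hv)]
  congr 1
  ext w
  rw [SimpleGraph.mem_neighborFinset, Finset.mem_insert]
  constructor
  · intro h
    rcases adj_cases (r := r) hG h with h | h
    · exact Or.inr h
    · exact Or.inl h.2
  · rintro (rfl | h)
    · exact (parent_adj hG hv).symm
    · exact (mem_children.1 h).1

theorem dist_root_eq_zero_iff (hG : G.IsTree) {v : V} : G.dist r v = 0 ↔ v = r := by
  rw [hG.connected.dist_eq_zero_iff, eq_comm]

theorem levelCard_of_le {v : V} {k : ℕ} (h : k ≤ G.dist r v) : levelCard G r v k = 1 := by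
  simp [levelCard, Nat.sub_eq_zero_of_le h, numBelow]

/-- The identity that the robots evaluate. Thanks to the value 1 at and above depth `k`, it also
covers the level just below `v`, where it counts the children. -/
theorem levelCard_eq_sum {v : V} {k : ℕ} (h : G.dist r v < k) :
    levelCard G r v k = ∑ w ∈ children G r v, levelCard G r w k := by
  obtain ⟨j, rfl⟩ := Nat.exists_eq_add_of_lt h
  have : G.dist r v + j + 1 - G.dist r v = j + 1 := by omega
  rw [levelCard, this, numBelow]
  refine Finset.sum_congr rfl fun w hw => ?_
  rw [levelCard, (mem_children.1 hw).2]
  congr 1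
  omega

theorem numBelow_succ_eq_zero {j : ℕ} {v : V} (h : numBelow G r j v = 0) :
    numBelow G r (j + 1) v = 0 := by
  induction j generalizing v with
  | zero => simp [numBelow] at h
  | succ j ih =>
    rw [numBelow, Finset.sum_eq_zero_iff] at h ⊢
    exact fun w hw => ih (h w hw)

theorem levelCard_eq_zero_of_le {v : V} {k k' : ℕ} (hk : k ≤ k') (h : levelCard G r v k = 0) :
    levelCard G r v k' = 0 := by
  induction hk with
  | refl => exact h
  | @step m _ ih =>
    rw [levelCard] at ih ⊢
    rcases Nat.lt_or_ge m (G.dist r v) with h1 | h1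
    · simp [Nat.sub_eq_zero_of_le h1.le, numBelow] at ih
    · rw [Nat.succ_sub h1]
      exact numBelow_succ_eq_zero ih

theorem dist_lt_of_levelCard_eq_zero {v : V} {k : ℕ} (h : levelCard G r v k = 0) :
    G.dist r v < k := by
  by_contra h1
  rw [levelCard_of_le (not_lt.1 h1)] at h
  omega

/-- Puts emptiness of a level in the form that a robot tests: its counter of full child subtrees has
reached the number of children. -/
theorem levelCard_eq_zero_iff {v : V} {k : ℕ} (h : G.dist r v < k) :
    levelCard G r v k = 0 ↔
      ((children G r v).filter fun w => levelCard G r w k = 0).card = (children G r v).card := by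
  rw [levelCard_eq_sum h, Finset.sum_eq_zero_iff, Finset.card_filter_eq_iff]

/-- Descend from `m = k`: the sets of children of the nodes at depth `m` partition the nodes at
depth `m + 1`. -/
theorem sum_levelCard (hG : G.IsTree) {m k : ℕ} (h : m ≤ k) :
    ∑ v with G.dist r v = m, levelCard G r v k = (Finset.univ.filter fun v => G.dist r v = k).card := by
  induction h using Nat.decreasingInduction with
  | self =>
    rw [Finset.card_eq_sum_ones]
    refine Finset.sum_congr rfl fun v hv => levelCard_of_le ?_
    simpa using (Finset.mem_filter.1 hv).2.ge
  | of_succ m hm ih =>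
    rw [← ih]
    have h1 : ∑ v with G.dist r v = m, levelCard G r v k
        = ∑ v with G.dist r v = m, ∑ w ∈ children G r v, levelCard G r w k := by
      refine Finset.sum_congr rfl fun v hv => levelCard_eq_sum ?_
      rw [(Finset.mem_filter.1 hv).2]
      exact hm
    rw [h1, ← Finset.sum_biUnion]
    · refine Finset.sum_congr ?_ fun _ _ => rfl
      ext w
      simp only [Finset.mem_biUnion, Finset.mem_filter, Finset.mem_univ, true_and]
      constructor
      · rintro ⟨v, hv, hw⟩
        rw [(mem_children.1 hw).2, hv]
      · intro hw
        have hr : w ≠ r := by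
          rintro rfl
          simp at hw
        refine ⟨parent G r w, ?_, mem_children_parent hG hr⟩
        have := dist_parent hG hr
        omega
    · intro v _ v' _ hne
      rw [Function.onFun, Finset.disjoint_left]
      exact fun w hw hw' => hne (eq_of_mem_children hG hw hw')

theorem levelCard_root (hG : G.IsTree) (k : ℕ) :
    levelCard G r r k = (Finset.univ.filter fun v => G.dist r v = k).card := by
  rw [← sum_levelCard hG (Nat.zero_le k)]
  have : (Finset.univ.filter fun v => G.dist r v = 0) = {r} := by
    ext v
    simp [dist_root_eq_zero_iff hG]
  rw [this, Finset.sum_singleton]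

theorem levelCard_le_root (hG : G.IsTree) {v : V} {k : ℕ} (h : G.dist r v ≤ k) :
    levelCard G r v k ≤ levelCard G r r k := by
  rw [levelCard_root hG, ← sum_levelCard hG h]
  exact Finset.single_le_sum (f := fun v => levelCard G r v k) (fun _ _ => Nat.zero_le _)
    (by simp)

theorem levelCard_le_card (hG : G.IsTree) (v : V) (k : ℕ) :
    levelCard G r v k ≤ Fintype.card V := by
  rcases le_total k (G.dist r v) with h | h
  · rw [levelCard_of_le h]
    exact Fintype.card_pos_iff.2 ⟨v⟩
  · refine (levelCard_le_root hG h).trans ?_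
    rw [levelCard_root hG]
    exact Finset.card_le_univ _

theorem dist_lt_card (hG : G.IsTree) (v : V) : G.dist r v < Fintype.card V := by
  obtain ⟨p, hp, hl⟩ := hG.connected.exists_path_of_dist r v
  rw [← hl]
  exact hp.length_lt

theorem levelCard_root_card (hG : G.IsTree) : levelCard G r r (Fintype.card V) = 0 := by
  rw [levelCard_root hG, Finset.card_eq_zero, Finset.filter_eq_empty_iff]
  exact fun v _ => (dist_lt_card hG v).ne

variable (P : PortNumbering G)

theorem PortNumbering.port_lt {v w : V} (h : G.Adj v w) : P.port v w < G.degree v := by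
  rw [port, dif_pos h]
  exact Fin.is_lt _

theorem PortNumbering.port_le (v w : V) : P.port v w ≤ Fintype.card V := by
  by_cases h : G.Adj v w
  · exact (P.port_lt h).le.trans (G.degree_lt_card_verts v).le
  · simp [port, h]

theorem PortNumbering.cross_port {v w : V} (h : G.Adj v w) :
    P.cross v (P.port v w) = some (w, P.port w v) := by
  have h1 : P.port v w = P v ⟨w, h⟩ := dif_pos h
  have h2 : P.port w v = P w ⟨v, h.symm⟩ := dif_pos h.symm
  have h3 : (P v).symm ⟨P.port v w, P.port_lt h⟩ = ⟨w, h⟩ := by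
    rw [Equiv.symm_apply_eq]
    exact Fin.ext h1
  rw [PortNumbering.cross, dif_pos (P.port_lt h)]
  rw [h2]
  -- The type of the entry port depends on the neighbour, so the neighbour is generalized before
  -- substituting.
  have key : ∀ z : G.neighborSet v, z = ⟨w, h⟩ →
      ((z : V), (P z ⟨v, z.2.symm⟩ : ℕ)) = (w, (P w ⟨v, h.symm⟩ : ℕ)) := by
    rintro _ rfl
    rfl
  exact congrArg some (key _ h3)

theorem PortNumbering.exists_port {v : V} {p : ℕ} (h : p < G.degree v) :
    ∃ w, G.Adj v w ∧ P.port v w = p := by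
  refine ⟨(P v).symm ⟨p, h⟩, ((P v).symm ⟨p, h⟩).2, ?_⟩
  have h1 : G.Adj v ((P v).symm ⟨p, h⟩ : V) := ((P v).symm ⟨p, h⟩).2
  rw [port, dif_pos h1]
  exact congrArg Fin.val ((P v).apply_symm_apply ⟨p, h⟩)

theorem PortNumbering.port_injOn {v w w' : V} (h : G.Adj v w) (h' : G.Adj v w')
    (he : P.port v w = P.port v w') : w = w' := by
  rw [port, dif_pos h, port, dif_pos h'] at he
  have := (P v).injective (Fin.ext he)
  exact congrArg Subtype.val this

end Tree

/-! ### Observations as counts and sums over robots. -/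

section Observations

variable {V M : Type*} [DecidableEq V] {G : SimpleGraph V} [G.LocallyFinite] {n : ℕ}

theorem Config.countP_here (C : Config n V M) (i : Fin n) (p : M × Option ℕ → Prop)
    [DecidablePred p] :
    (C.obs G i).here.countP p =
      (Finset.univ.filter fun j => C.pos j = C.pos i ∧ p (C.mem j, C.arr j)).card := by
  rw [Config.obs, Multiset.countP_map, ← Finset.filter_val, Finset.filter_filter]
  rfl

theorem Config.sum_here (C : Config n V M) (i : Fin n) (f : M × Option ℕ → ℕ) :
    ((C.obs G i).here.map f).sum = ∑ j with C.pos j = C.pos i, f (C.mem j, C.arr j) := by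
  rw [Config.obs, Multiset.map_map]
  rfl

theorem Config.informers_eq (C : Config n V Mem) (i : Fin n) :
    (C.obs G i).informers =
      (Finset.univ.filter fun j => C.pos j = C.pos i ∧ (C.mem j).Informs).val.map
        fun j => (C.mem j, C.arr j) := by
  rw [Obs.informers, Config.obs, Multiset.filter_map, ← Finset.filter_filter]
  rfl

theorem Config.card_informers (C : Config n V Mem) (i : Fin n) :
    (C.obs G i).informers.card =
      (Finset.univ.filter fun j => C.pos j = C.pos i ∧ (C.mem j).Informs).card := by
  rw [C.informers_eq, Multiset.card_map]
  rfl

theorem Config.sum_informers (C : Config n V Mem) (i : Fin n) (f : Mem × Option ℕ → ℕ) :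
    ((C.obs G i).informers.map f).sum =
      ∑ j with C.pos j = C.pos i ∧ (C.mem j).Informs, f (C.mem j, C.arr j) := by
  rw [C.informers_eq, Multiset.map_map]
  rfl

theorem Config.countP_informers (C : Config n V Mem) (i : Fin n) (p : Mem × Option ℕ → Prop)
    [DecidablePred p] :
    (C.obs G i).informers.countP p = (Finset.univ.filter fun j =>
      (C.pos j = C.pos i ∧ (C.mem j).Informs) ∧ p (C.mem j, C.arr j)).card := by
  rw [C.informers_eq, Multiset.countP_map, ← Finset.filter_val, Finset.filter_filter]
  rfl

theorem Config.sum_filter_informers (C : Config n V Mem) (i : Fin n)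
    (p : Mem × Option ℕ → Prop) [DecidablePred p] (f : Mem × Option ℕ → ℕ) :
    (((C.obs G i).informers.filter p).map f).sum =
      ∑ j with C.pos j = C.pos i ∧ (C.mem j).Informs,
        if p (C.mem j, C.arr j) then f (C.mem j, C.arr j) else 0 := by
  rw [C.informers_eq, Multiset.filter_map, Multiset.map_map, ← Finset.filter_val,
    ← Finset.sum_filter]
  rfl

theorem RobotAlgorithm.round_stay (alg : RobotAlgorithm M) (P : PortNumbering G)
    (C : Config n V M) {i : Fin n} (h : (alg.act (C.obs G i)).2 = none) :
    (alg.round P C).pos i = C.pos i ∧ (alg.round P C).arr i = none := by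
  simp [RobotAlgorithm.round, h]

theorem RobotAlgorithm.round_cross (alg : RobotAlgorithm M) (P : PortNumbering G)
    (C : Config n V M) {i : Fin n} {p q : ℕ} {w : V} (h : (alg.act (C.obs G i)).2 = some p)
    (hp : P.cross (C.pos i) p = some (w, q)) :
    (alg.round P C).pos i = w ∧ (alg.round P C).arr i = some q := by
  simp [RobotAlgorithm.round, h, hp]

theorem RobotAlgorithm.round_mem (alg : RobotAlgorithm M) (P : PortNumbering G)
    (C : Config n V M) (i : Fin n) :
    (alg.round P C).mem i = (alg.act (C.obs G i)).1 := rfl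

end Observations

/-! ### Distributing list entries by rank. -/

section Ranks

theorem List.sum_map_range (f : ℕ → ℕ) (m : ℕ) :
    ((List.range m).map f).sum = ∑ k ∈ Finset.range m, f k := by
  induction m with
  | zero => simp
  | succ m ih => rw [List.range_succ, List.map_append, List.sum_append, ih, Finset.sum_range_succ]; simp

/-- Positions beyond the end read `none`, so a range longer than the list, as for a surplus of
robots, gives the same count. -/
theorem List.card_filter_getElem? {α : Type*} [DecidableEq α] (l : List α) (a : α) {m : ℕ}
    (h : l.length ≤ m) :
    ((Finset.range m).filter fun k => l[k]? = some a).card = l.count a := by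
  induction l generalizing m with
  | nil => simp
  | cons b l ih =>
    obtain ⟨m, rfl⟩ : ∃ m', m = m' + 1 := ⟨m - 1, by simp at h; omega⟩
    rw [Finset.card_filter, Finset.sum_range_succ', List.count_cons]
    simp only [List.getElem?_cons_succ, List.getElem?_cons_zero, Option.some.injEq, beq_iff_eq]
    rw [← Finset.card_filter, ih (by simpa using h)]

variable {ι : Type*} [DecidableEq ι]

/-- The rank is strictly increasing in `f`, hence injective on `E`, and it is less than the size of
`E`; counting gives surjectivity. -/
theorem image_rank (E : Finset ι) (f : ι → ℕ) (hf : Set.InjOn f E) :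
    E.image (fun i => (E.filter fun j => f j < f i).card) = Finset.range E.card := by
  have hlt : ∀ i ∈ E, ∀ j ∈ E, f i < f j →
      (E.filter fun k => f k < f i).card < (E.filter fun k => f k < f j).card := by
    intro i hi j hj hij
    refine Finset.card_lt_card ?_
    rw [Finset.ssubset_iff_of_subset]
    · exact ⟨i, by simp [hi, hij], by simp⟩
    · intro k hk
      rw [Finset.mem_filter] at hk ⊢
      exact ⟨hk.1, hk.2.trans hij⟩
  apply Finset.eq_of_subset_of_card_le
  · intro m hm
    obtain ⟨i, hi, rfl⟩ := Finset.mem_image.1 hm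
    rw [Finset.mem_range]
    exact Finset.card_lt_card (Finset.filter_ssubset.2 ⟨i, hi, by simp⟩)
  · rw [Finset.card_range, Finset.card_image_of_injOn]
    intro i hi j hj hij
    by_contra hne
    have hfne : f i ≠ f j := fun h => hne (hf hi hj h)
    rcases lt_or_gt_of_ne hfne with h | h
    · exact (hlt i hi j hj h).ne hij
    · exact (hlt j hj i hi h).ne hij.symm

theorem rank_injOn (E : Finset ι) (f : ι → ℕ) (hf : Set.InjOn f E) :
    Set.InjOn (fun i => (E.filter fun j => f j < f i).card) E := by
  apply Finset.injOn_of_card_image_eq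
  rw [image_rank E f hf, Finset.card_range]

/-- With `E` the explorers at a node, `f` the labels and `l` the list of ports with repetitions,
every port receives exactly the number of robots listed for it. -/
theorem card_filter_getElem?_rank {α : Type*} [DecidableEq α] (E : Finset ι) (f : ι → ℕ)
    (hf : Set.InjOn f E) (l : List α) (hl : l.length ≤ E.card) (a : α) :
    (E.filter fun i => l[(E.filter fun j => f j < f i).card]? = some a).card = l.count a := by
  rw [← l.card_filter_getElem? a hl, ← image_rank E f hf, Finset.filter_image,
    Finset.card_image_of_injOn]
  exact (rank_injOn E f hf).mono fun x hx => (Finset.mem_filter.1 hx).1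

end Ranks

/-! ### The invariant of a round within a stage. -/

section Invariant

variable {V : Type*} [Fintype V] [DecidableEq V] {G : SimpleGraph V} [DecidableRel G.Adj] {n : ℕ}

/-- In round `k` of stage `L`, there is a robot assigned to the node `v`. -/
abbrev Occupied (G : SimpleGraph V) (r : V) (L k : ℕ) (v : V) : Prop :=
  G.dist r v + 1 < L ∨ (G.dist r v + 1 = L ∧ (L < k ∨ v = r))

/-- In round `k` of stage `L`, settled robots of nodes at depth `d` visit their parent nodes. -/
abbrev VisitRound (L k d : ℕ) : Prop := k = d ∨ k + d = 2 * L + 1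

/-- The last stage whose outcome a node at depth `d` knows in round `k` of stage `L`. -/
def knownStage (L k d : ℕ) : ℕ := if 2 * L < k + d then L else L - 1

/-- The robot of `v` is running in round `k` of stage `L`; it knows the outcome of stage `K`, and
it is at the parent node if `up` holds. -/
structure ActiveNode (P : PortNumbering G) (r : V) (L k K : ℕ) (up : Prop) (v : V) (x : Mem)
    (p : V) (a : Option ℕ) : Prop where
  stopped : x.stopped = false
  lvl : x.lvlCntr = L
  rnd : x.rndCntr = k
  dist : x.distFromRoot = G.dist r v
  state : x.state = if v = r then RobotState.root else RobotState.settled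
  parentPtr : x.parentPtr = if v = r then none else some (P.port v (parent G r v))
  entered : x.portEntered ≤ Fintype.card V
  count : x.fullyDispersedPort =
    ((children G r v).filter fun w => levelCard G r w K = 0).card
  full : x.fullyDispersed = decide (levelCard G r v K = 0)
  reqd : x.numRobotsReqd =
    if v = r then G.degree r
    else if G.dist r v + 1 = L then levelCard G r v L else levelCard G r v K
  pos_up : v ≠ r → up → p = parent G r v ∧ a = some (P.port (parent G r v) v)
  pos_home : (v = r ∨ ¬ up) → p = v
  arr_root : v = r → a = none

/-- Bounds for the variables of a robot. -/
structure Mem.Small (n : ℕ) (x : Mem) : Prop where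
  entered : x.portEntered ≤ n
  ptr : ∀ q ∈ x.parentPtr, q ≤ n
  dist : x.distFromRoot ≤ n
  count : x.fullyDispersedPort ≤ n
  reqd : x.numRobotsReqd ≤ n
  lvl_pos : 1 ≤ x.lvlCntr
  lvl : x.lvlCntr ≤ n + 1
  rnd : x.rndCntr ≤ 2 * n + 3

/-- The robot of `v` has stopped. -/
structure StoppedNode (v : V) (x : Mem) (p : V) : Prop where
  stopped : x.stopped = true
  state : x.state = RobotState.root ∨ x.state = RobotState.settled
  pos : p = v
  small : x.Small (Fintype.card V)

/-- A robot that is not assigned to a node in round `k` of stage `L`. -/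
structure FreeRobot (P : PortNumbering G) (r : V) (L k : ℕ) (x : Mem) (p : V) (a : Option ℕ) :
    Prop where
  stopped : x.stopped = false
  lvl : x.lvlCntr = L
  rnd : x.rndCntr = k
  dist : x.distFromRoot = G.dist r p
  parentPtr : x.parentPtr = none
  entered : x.portEntered ≤ Fintype.card V
  count : x.fullyDispersedPort = 0
  full : x.fullyDispersed = false
  reqd : x.numRobotsReqd = 0
  place : (p = r ∧ a = none ∧ x.state = if k = 1 then RobotState.explore else RobotState.wait) ∨
    (2 ≤ k ∧ k ≤ L ∧ G.dist r p + 1 = k ∧ x.state = RobotState.explore ∧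
      a = some (P.port p (parent G r p)))

/-- The configuration at the beginning of round `k` of stage `L`, where `own v` is the robot
assigned to the node `v`. -/
structure StageInv (P : PortNumbering G) (r : V) (lab : Fin n → ℕ) (L k : ℕ) (C : Config n V Mem)
    (own : V → Fin n) : Prop where
  label : ∀ i, (C.mem i).label = lab i
  inj : ∀ v w, Occupied G r L k v → Occupied G r L k w → own v = own w → v = w
  active : ∀ v, Occupied G r L k v → levelCard G r v (L - 1) ≠ 0 →
    ActiveNode P r L k (knownStage L k (G.dist r v)) (VisitRound L k (G.dist r v)) v
      (C.mem (own v)) (C.pos (own v)) (C.arr (own v))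
  stopped : ∀ v, Occupied G r L k v → levelCard G r v (L - 1) = 0 →
    StoppedNode v (C.mem (own v)) (C.pos (own v))
  free : ∀ i, (∀ v, Occupied G r L k v → own v ≠ i) →
    FreeRobot P r L k (C.mem i) (C.pos i) (C.arr i)
  explorers : 2 ≤ k → k ≤ L → ∀ v, G.dist r v + 1 = k →
    (Finset.univ.filter fun i => C.pos i = v ∧ (C.mem i).state = RobotState.explore).card =
      levelCard G r v (L - 1)

variable {P : PortNumbering G} {r : V} {lab : Fin n → ℕ} {L k : ℕ} {C : Config n V Mem}
  {own : V → Fin n}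

theorem Occupied.depth_le {v : V} (h : Occupied G r L k v) : G.dist r v + 1 ≤ L := by
  rcases h with h | h <;> omega

theorem Occupied.depth_lt_or {v : V} (h : Occupied G r L k v) (hv : v ≠ r) :
    G.dist r v + 1 < L ∨ (G.dist r v + 1 = L ∧ L < k) := by
  rcases h with h | ⟨h, h1 | h1⟩
  · exact Or.inl h
  · exact Or.inr ⟨h, h1⟩
  · exact absurd h1 hv

theorem one_le_dist (hG : G.IsTree) {v : V} (hv : v ≠ r) : 1 ≤ G.dist r v := by
  have := dist_parent hG hv
  omega

theorem occupied_root (hL : 1 ≤ L) : Occupied G r L k r := by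
  have : G.dist r r = 0 := SimpleGraph.dist_self
  rcases hL.lt_or_eq with h | h
  · exact Or.inl (by omega)
  · exact Or.inr ⟨by omega, Or.inr rfl⟩

namespace ActiveNode

variable {K : ℕ} {up : Prop} {v p : V} {x : Mem} {a : Option ℕ}

theorem state_root (h : ActiveNode P r L k K up r x p a) : x.state = RobotState.root := by
  simpa using h.state

theorem state_settled (h : ActiveNode P r L k K up v x p a) (hv : v ≠ r) :
    x.state = RobotState.settled := by
  simpa [hv] using h.state

theorem goesUp_iff (h : ActiveNode P r L k K up v x p a) :
    x.GoesUp ↔ k + 1 = G.dist r v ∨ k + G.dist r v = 2 * L ∨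
      (G.dist r v = 1 ∧ k = 2 * L + 1 ∧ levelCard G r v K ≠ 0) := by
  rw [Mem.GoesUp, h.lvl, h.rnd, h.dist, h.full]
  simp

theorem atParent_iff (h : ActiveNode P r L k K up v x p a) (hG : G.IsTree) (hv : v ≠ r)
    (ho : Occupied G r L k v) : x.AtParent ↔ VisitRound L k (G.dist r v) := by
  rw [Mem.AtParent, h.goesUp_iff, h.lvl, h.rnd, h.dist, VisitRound]
  have h1 := one_le_dist hG hv
  have h2 := ho.depth_le
  constructor
  · exact fun h => h.2
  · refine fun h => ⟨?_, h⟩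
    rintro (h3 | h3 | ⟨h3, h4, -⟩) <;> omega

theorem informs_iff (h : ActiveNode P r L k K up v x p a) (hG : G.IsTree)
    (ho : Occupied G r L k v) : x.Informs ↔ v ≠ r ∧ VisitRound L k (G.dist r v) := by
  rw [Mem.Informs]
  by_cases hv : v = r
  · subst hv
    simp [h.state_root]
  · simp [h.stopped, h.state_settled hv, h.atParent_iff hG hv ho, hv]

end ActiveNode

theorem FreeRobot.state_cases {x : Mem} {p : V} {a : Option ℕ} (h : FreeRobot P r L k x p a) :
    x.state = RobotState.explore ∨ x.state = RobotState.wait := by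
  rcases h.place with ⟨-, -, h⟩ | ⟨-, -, -, h, -⟩
  · rw [h]
    split_ifs <;> simp
  · exact Or.inl h

theorem StoppedNode.not_informs {v p : V} {x : Mem} (h : StoppedNode v x p) : ¬ x.Informs := by
  simp [Mem.Informs, h.stopped]

namespace StageInv

theorem owner_or_free (own : V → Fin n) (r : V) (L k : ℕ) (i : Fin n) :
    (∃ v, Occupied G r L k v ∧ own v = i) ∨ ∀ v, Occupied G r L k v → own v ≠ i := by
  by_cases h : ∃ v, Occupied G r L k v ∧ own v = i
  · exact Or.inl h
  · exact Or.inr fun v hv he => h ⟨v, hv, he⟩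

variable (h : StageInv P r lab L k C own)
include h

theorem state_explore_free {i : Fin n} (hi : (C.mem i).state = RobotState.explore) :
    ∀ v, Occupied G r L k v → own v ≠ i := by
  rintro v hv rfl
  by_cases hl : levelCard G r v (L - 1) = 0
  · have := (h.stopped v hv hl).state
    simp [hi] at this
  · have := (h.active v hv hl).state
    rw [hi] at this
    split_ifs at this

/-- Free and stopped robots never speak, and a running owner speaks only at the parent of its node.
This turns sums over messages heard at `u` into sums over children of `u`. -/
theorem informs_iff (hG : G.IsTree) (u : V) (j : Fin n) :
    (C.pos j = u ∧ (C.mem j).Informs) ↔ ∃ w ∈ (children G r u).filter fun w =>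
      Occupied G r L k w ∧ levelCard G r w (L - 1) ≠ 0 ∧ VisitRound L k (G.dist r w),
      own w = j := by
  simp only [Finset.mem_filter]
  constructor
  · rintro ⟨hp, hi⟩
    rcases owner_or_free (G := G) own r L k j with ⟨w, hw, rfl⟩ | hf
    · by_cases hl : levelCard G r w (L - 1) = 0
      · exact absurd hi (h.stopped w hw hl).not_informs
      · have ha := h.active w hw hl
        obtain ⟨hr, hv⟩ := (ha.informs_iff hG hw).1 hi
        refine ⟨w, ⟨?_, hw, hl, hv⟩, rfl⟩
        rw [← hp, (ha.pos_up hr hv).1]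
        exact mem_children_parent hG hr
    · rcases (h.free j hf).state_cases with h1 | h1 <;> simp [Mem.Informs, h1] at hi
  · rintro ⟨w, ⟨hc, ho, hl, hv⟩, rfl⟩
    have ha := h.active w ho hl
    have hr := ne_root_of_mem_children hc
    exact ⟨by rw [(ha.pos_up hr hv).1, parent_eq hG hc], (ha.informs_iff hG ho).2 ⟨hr, hv⟩⟩

theorem informers_image (hG : G.IsTree) (u : V) :
    (Finset.univ.filter fun j => C.pos j = u ∧ (C.mem j).Informs) =
      ((children G r u).filter fun w => Occupied G r L k w ∧ levelCard G r w (L - 1) ≠ 0 ∧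
        VisitRound L k (G.dist r w)).image own := by
  ext j
  rw [Finset.mem_filter, Finset.mem_image, ← h.informs_iff hG]
  simp

theorem own_injOn (p : V → Prop) [DecidablePred p] (s : Finset V) :
    Set.InjOn own (s.filter fun w => Occupied G r L k w ∧ p w) := by
  intro v hv w hw he
  simp only [Finset.coe_filter, Set.mem_ofPred_eq] at hv hw
  exact h.inj v w hv.2.1 hw.2.1 he

theorem sum_informing (hG : G.IsTree) (u : V) (f : Fin n → ℕ) :
    ∑ j with C.pos j = u ∧ (C.mem j).Informs, f j =
      ∑ w ∈ children G r u with Occupied G r L k w ∧ levelCard G r w (L - 1) ≠ 0 ∧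
        VisitRound L k (G.dist r w), f (own w) := by
  rw [h.informers_image hG, Finset.sum_image (h.own_injOn _ _)]

/-- An owner that is away is visiting its parent node and hence informs, which `Mem.AtHome`
excludes. So visitors are not mistaken for the robot assigned to `u`. -/
theorem atHome_own (hG : G.IsTree) {u : V} {j : Fin n} (hp : C.pos j = u)
    (hj : (C.mem j).AtHome) : Occupied G r L k u ∧ own u = j := by
  rcases owner_or_free (G := G) own r L k j with ⟨w, hw, rfl⟩ | hf
  · by_cases hl : levelCard G r w (L - 1) = 0
    · have := (h.stopped w hw hl).pos
      rw [← hp, this]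
      exact ⟨hw, rfl⟩
    · have ha := h.active w hw hl
      have : C.pos (own w) = w := by
        apply ha.pos_home
        by_cases hr : w = r
        · exact Or.inl hr
        · right
          intro hv
          rcases hj with hj | hj
          · rw [ha.state_settled hr] at hj
            cases hj
          · exact hj.2 ((ha.informs_iff hG hw).2 ⟨hr, hv⟩)
      rw [← hp, this]
      exact ⟨hw, rfl⟩
  · rcases (h.free j hf).state_cases with h1 | h1 <;> simp [Mem.AtHome, h1] at hj

theorem own_atHome (hG : G.IsTree) {u : V} (ho : Occupied G r L k u)
    (hl : levelCard G r u (L - 1) ≠ 0) (hu : u = r ∨ ¬ VisitRound L k (G.dist r u)) :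
    C.pos (own u) = u ∧ (C.mem (own u)).AtHome := by
  have ha := h.active u ho hl
  refine ⟨ha.pos_home hu, ?_⟩
  by_cases hr : u = r
  · subst hr
    exact Or.inl ha.state_root
  · refine Or.inr ⟨ha.state_settled hr, fun hi => ?_⟩
    have := ((ha.informs_iff hG ho).1 hi).2
    tauto

end StageInv

end Invariant

/-! ### One round of the robots assigned to nodes. -/

section NodeStep

variable {V : Type*} [Fintype V] [DecidableEq V] {G : SimpleGraph V} [DecidableRel G.Adj] {n : ℕ}
  {P : PortNumbering G} {r : V} {lab : Fin n → ℕ} {L k : ℕ} {C : Config n V Mem}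
  {own : V → Fin n}

theorem knownStage_le_succ (L k d : ℕ) : knownStage L k d ≤ knownStage L (k + 1) d := by
  unfold knownStage
  split_ifs <;> omega

theorem knownStage_succ {d : ℕ} (h : k + d ≠ 2 * L) :
    knownStage L (k + 1) d = knownStage L k d := by
  unfold knownStage
  split_ifs <;> omega

theorem le_knownStage (L k d : ℕ) : L - 1 ≤ knownStage L k d := by
  unfold knownStage
  split_ifs <;> omega

/-- Emptiness is monotone in the level, so keeping an old `true` is harmless. The side condition
excludes a leaf at depth at least `K'`, whose counter test `0 = 0` would succeed although its value
is still 1. -/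
theorem decide_levelCard {v : V} {K K' : ℕ} (hK : K ≤ K')
    (h : G.dist r v < K' ∨ 0 < (children G r v).card) :
    (decide (levelCard G r v K = 0) ||
      decide (((children G r v).filter fun w => levelCard G r w K' = 0).card =
        (children G r v).card)) = decide (levelCard G r v K' = 0) := by
  rw [← Bool.decide_or, decide_eq_decide]
  by_cases hd : G.dist r v < K'
  · rw [← levelCard_eq_zero_iff hd]
    exact ⟨fun h => h.elim (levelCard_eq_zero_of_le hK) id, Or.inr⟩
  · have h1 : levelCard G r v K = 1 := levelCard_of_le (by omega)
    have h2 : levelCard G r v K' = 1 := levelCard_of_le (by omega)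
    have h3 : ((children G r v).filter fun w => levelCard G r w K' = 0) = ∅ := by
      refine Finset.filter_eq_empty_iff.2 fun w hw => ?_
      rw [levelCard_of_le]
      · simp
      · have := (mem_children.1 hw).2
        omega
    rw [h1, h2, h3, Finset.card_empty]
    omega

namespace StageInv

/-- Children at depth `d + 1` visit in rounds `d + 1` and `2L - d`. The first bound is strict
because nodes at depth `L - 1` get their robots only in round `L`. -/
theorem visitors_eq {v : V}
    (hk : (k + G.dist r v = 2 * L ∧ G.dist r v + 2 ≤ L) ∨
      (k = G.dist r v + 1 ∧ G.dist r v + 2 < L)) :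
    ((children G r v).filter fun w => Occupied G r L k w ∧ levelCard G r w (L - 1) ≠ 0 ∧
      VisitRound L k (G.dist r w)) =
    (children G r v).filter fun w => levelCard G r w (L - 1) ≠ 0 := by
  refine Finset.filter_congr fun w hw => ?_
  have := (mem_children.1 hw).2
  refine ⟨fun h => h.2.1, fun h => ⟨?_, h, ?_⟩⟩
  · unfold Occupied
    omega
  · unfold VisitRound
    omega

theorem visitors_eq_empty {v : V}
    (hk : ¬ ((k + G.dist r v = 2 * L ∧ G.dist r v + 2 ≤ L) ∨
      (k = G.dist r v + 1 ∧ G.dist r v + 2 < L))) :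
    ((children G r v).filter fun w => Occupied G r L k w ∧ levelCard G r w (L - 1) ≠ 0 ∧
      VisitRound L k (G.dist r w)) = ∅ := by
  refine Finset.filter_eq_empty_iff.2 fun w hw => ?_
  rintro ⟨h1, -, h2⟩
  have h3 := (mem_children.1 hw).2
  have h4 := h1.depth_lt_or (ne_root_of_mem_children hw)
  unfold VisitRound at h2
  omega

/-- Makes the default for "no visitor" unambiguous: in a visiting round, a node with descendants at
depth `L - 1` hears at least one child, even if others have stopped. -/
theorem visitors_nonempty {v : V} (hv : levelCard G r v (L - 1) ≠ 0) (hd : G.dist r v + 2 ≤ L) :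
    ((children G r v).filter fun w => levelCard G r w (L - 1) ≠ 0).Nonempty := by
  rw [Finset.nonempty_iff_ne_empty]
  intro h
  rw [Finset.filter_eq_empty_iff] at h
  apply hv
  rw [levelCard_eq_sum (by omega)]
  exact Finset.sum_eq_zero fun w hw => not_not.1 (h hw)

variable (h : StageInv P r lab L k C own)
include h

theorem card_informing (hG : G.IsTree) (u : V) :
    (Finset.univ.filter fun j => C.pos j = u ∧ (C.mem j).Informs).card =
      ((children G r u).filter fun w => Occupied G r L k w ∧ levelCard G r w (L - 1) ≠ 0 ∧
        VisitRound L k (G.dist r w)).card := by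
  rw [Finset.card_eq_sum_ones, h.sum_informing hG, Finset.card_eq_sum_ones]

/-- No child is counted twice: children full by stage `L - 1` have stopped and are silent. The
others report the flag for stage `L` in round `2L - d`, while on any other visit their flag is still
the one for `L - 1`, hence false. -/
theorem count_step (hG : G.IsTree) (v : V) :
    ((children G r v).filter fun w => levelCard G r w (knownStage L k (G.dist r v)) = 0).card +
      (Finset.univ.filter fun j => (C.pos j = v ∧ (C.mem j).Informs) ∧
        (C.mem j).fullyDispersed = true).card =
    ((children G r v).filter fun w =>
      levelCard G r w (knownStage L (k + 1) (G.dist r v)) = 0).card := by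
  rw [← Finset.filter_filter, Finset.card_filter (fun j => (C.mem j).fullyDispersed = true),
    h.sum_informing hG, ← Finset.card_filter, Finset.filter_filter]
  have hfull : ∀ w ∈ children G r v, (Occupied G r L k w ∧ levelCard G r w (L - 1) ≠ 0 ∧
      VisitRound L k (G.dist r w)) →
      ((C.mem (own w)).fullyDispersed = true ↔
        levelCard G r w (knownStage L k (G.dist r v + 1)) = 0) := by
    intro w hw hv
    rw [(h.active w hv.1 hv.2.1).full, (mem_children.1 hw).2, decide_eq_true_iff]
  by_cases hk : k + G.dist r v = 2 * L
  · have e1 : knownStage L k (G.dist r v) = L - 1 := if_neg (by omega)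
    have e2 : knownStage L (k + 1) (G.dist r v) = L := if_pos (by omega)
    have e3 : knownStage L k (G.dist r v + 1) = L := if_pos (by omega)
    rw [e1, e2, ← Finset.card_union_of_disjoint]
    · congr 1
      ext w
      simp only [Finset.mem_union, Finset.mem_filter]
      constructor
      · rintro (⟨hw, hz⟩ | ⟨hw, hv, hf⟩)
        · exact ⟨hw, levelCard_eq_zero_of_le (by omega) hz⟩
        · exact ⟨hw, by rwa [hfull w hw hv, e3] at hf⟩
      · rintro ⟨hw, hz⟩
        by_cases hz1 : levelCard G r w (L - 1) = 0
        · exact Or.inl ⟨hw, hz1⟩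
        · right
          have h1 := (mem_children.1 hw).2
          have h2 := dist_lt_of_levelCard_eq_zero hz
          have hv : Occupied G r L k w ∧ levelCard G r w (L - 1) ≠ 0 ∧
              VisitRound L k (G.dist r w) := by
            refine ⟨?_, hz1, ?_⟩
            · unfold Occupied
              omega
            · unfold VisitRound
              omega
          refine ⟨hw, hv, ?_⟩
          rwa [hfull w hw hv, e3]
    · rw [Finset.disjoint_left]
      intro w hw hw'
      exact (Finset.mem_filter.1 hw').2.1.2.1 (Finset.mem_filter.1 hw).2
  · rw [knownStage_succ hk, Nat.add_eq_left, Finset.card_eq_zero, Finset.filter_eq_empty_iff]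
    rintro w hw ⟨hv, hf⟩
    rw [hfull w hw hv] at hf
    have h1 := (mem_children.1 hw).2
    have h2 := hv.1.depth_le
    have h3 := hv.2.2
    unfold VisitRound at h3
    have e3 : knownStage L k (G.dist r v + 1) = L - 1 := if_neg (by omega)
    rw [e3] at hf
    exact hv.2.1 hf

theorem child_reqd {v w : V} (hw : w ∈ children G r v) (ho : Occupied G r L k w)
    (hl : levelCard G r w (L - 1) ≠ 0)
    (hk : (k + G.dist r v = 2 * L ∧ G.dist r v + 2 ≤ L) ∨
      (k = G.dist r v + 1 ∧ G.dist r v + 2 < L)) :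
    (C.mem (own w)).numRobotsReqd = levelCard G r w (knownStage L (k + 1) (G.dist r v)) := by
  rw [(h.active w ho hl).reqd, if_neg (ne_root_of_mem_children hw), (mem_children.1 hw).2]
  rcases hk with hk | hk
  · have e2 : knownStage L (k + 1) (G.dist r v) = L := if_pos (by omega)
    have e3 : knownStage L k (G.dist r v + 1) = L := if_pos (by omega)
    rw [e2, e3, ite_self]
  · have e2 : knownStage L (k + 1) (G.dist r v) = L - 1 := if_neg (by omega)
    have e3 : knownStage L k (G.dist r v + 1) = L - 1 := if_neg (by omega)
    rw [e2, e3, if_neg (by omega)]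

theorem sum_reqd (hG : G.IsTree) {v : V}
    (hk : (k + G.dist r v = 2 * L ∧ G.dist r v + 2 ≤ L) ∨
      (k = G.dist r v + 1 ∧ G.dist r v + 2 < L)) :
    ∑ j with C.pos j = v ∧ (C.mem j).Informs, (C.mem j).numRobotsReqd =
      levelCard G r v (knownStage L (k + 1) (G.dist r v)) := by
  have h1 := le_knownStage L (k + 1) (G.dist r v)
  rw [h.sum_informing hG, levelCard_eq_sum (by omega)]
  have h2 : ∀ w ∈ (children G r v).filter fun w => Occupied G r L k w ∧
      levelCard G r w (L - 1) ≠ 0 ∧ VisitRound L k (G.dist r w),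
      (C.mem (own w)).numRobotsReqd = levelCard G r w (knownStage L (k + 1) (G.dist r v)) := by
    intro w hw
    rw [Finset.mem_filter] at hw
    exact h.child_reqd hw.1 hw.2.1 hw.2.2.1 hk
  rw [Finset.sum_congr rfl h2, visitors_eq hk]
  -- A silent child has an empty level `L - 1`, hence also an empty level at the stage known now,
  -- and would add zero.
  refine Finset.sum_filter_of_ne fun w _ hne hz => hne ?_
  exact levelCard_eq_zero_of_le h1 hz

/-- With visitors the new sum is the required value. Without them nothing changes: either the known
stage stays the same, or `v` has depth `L - 1` and has stored the value for level `L` since it was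
settled. -/
theorem reqd_step (hG : G.IsTree) {v : V} (hr : v ≠ r) (ho : Occupied G r L k v)
    (hl : levelCard G r v (L - 1) ≠ 0) :
    (if (Finset.univ.filter fun j => C.pos j = v ∧ (C.mem j).Informs).card = 0 then
      (C.mem (own v)).numRobotsReqd
    else ∑ j with C.pos j = v ∧ (C.mem j).Informs, (C.mem j).numRobotsReqd) =
      if G.dist r v + 1 = L then levelCard G r v L
      else levelCard G r v (knownStage L (k + 1) (G.dist r v)) := by
  by_cases hk : (k + G.dist r v = 2 * L ∧ G.dist r v + 2 ≤ L) ∨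
      (k = G.dist r v + 1 ∧ G.dist r v + 2 < L)
  · rw [if_neg, h.sum_reqd hG hk, if_neg (by omega)]
    rw [h.card_informing hG, visitors_eq hk, Finset.card_eq_zero]
    exact (visitors_nonempty hl (by omega)).ne_empty
  · rw [if_pos, (h.active v ho hl).reqd, if_neg hr]
    · split_ifs with h1
      · rfl
      · rw [knownStage_succ]
        have := ho.depth_le
        omega
    · rw [h.card_informing hG, visitors_eq_empty hk, Finset.card_empty]

/-- The root robot counts arrivals rather than speakers. The two agree: free robots have a false
flag, a running owner at the root that is not informing is the root robot, which never arrives, and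
no stopped robot is at the root yet. -/
theorem entered_iff (hG : G.IsTree) (hr : levelCard G r r (L - 1) ≠ 0) (j : Fin n) :
    (C.pos j = r ∧ C.arr j ≠ none ∧ (C.mem j).fullyDispersed = true) ↔
      (C.pos j = r ∧ (C.mem j).Informs) ∧ (C.mem j).fullyDispersed = true := by
  rw [and_assoc]
  refine and_congr_right fun hp => and_congr_left fun hf => ?_
  constructor
  · intro ha
    rcases owner_or_free (G := G) own r L k j with ⟨w, hw, rfl⟩ | hfr
    · by_cases hl : levelCard G r w (L - 1) = 0
      · rw [(h.stopped w hw hl).pos] at hp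
        subst hp
        exact absurd hl hr
      · have hac := h.active w hw hl
        rw [hac.informs_iff hG hw]
        by_contra hc
        have hpos := hac.pos_home (by tauto)
        exact ha (hac.arr_root (hpos ▸ hp))
    · rw [(h.free j hfr).full] at hf
      cases hf
  · intro hi
    obtain ⟨w, hw, rfl⟩ := (h.informs_iff hG r j).1 ⟨hp, hi⟩
    simp only [Finset.mem_filter] at hw
    rw [((h.active w hw.2.1 hw.2.2.1).pos_up (ne_root_of_mem_children hw.1) hw.2.2.2).2]
    simp

end StageInv

theorem act_of_not_stopped {C : Config n V Mem} {i : Fin n} (h : (C.mem i).stopped = false) :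
    rootedTreeLogN.act (C.obs G i) = ((C.obs G i).body.1.tick, (C.obs G i).body.2) := by
  have : (C.obs G i).me.stopped = false := h
  simp [rootedTreeLogN, this]

theorem act_of_stopped {C : Config n V Mem} {i : Fin n} (h : (C.mem i).stopped = true) :
    rootedTreeLogN.act (C.obs G i) = (C.mem i, none) := by
  have : (C.obs G i).me.stopped = true := h
  simp only [rootedTreeLogN, this, if_true]
  rfl

/-- The robot of `v` is about to go to the parent node in round `k` of stage `L`. -/
abbrev LeavesUp (G : SimpleGraph V) [DecidableRel G.Adj] (r : V) (L k : ℕ) (v : V) : Prop :=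
  k + 1 = G.dist r v ∨ k + G.dist r v = 2 * L ∨
    (G.dist r v = 1 ∧ k = 2 * L + 1 ∧ levelCard G r v (knownStage L k (G.dist r v)) ≠ 0)

namespace StageInv

variable (h : StageInv P r lab L k C own)
include h

theorem body_root (hG : G.IsTree) (hdeg : 0 < G.degree r) (ho : Occupied G r L k r)
    (hl : levelCard G r r (L - 1) ≠ 0) :
    ActiveNode P r L k (knownStage L (k + 1) (G.dist r r)) (LeavesUp G r L k r) r
      (C.obs G (own r)).body.1
      ((rootedTreeLogN.round P C).pos (own r)) ((rootedTreeLogN.round P C).arr (own r)) := by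
  have ha := h.active r ho hl
  have hp : C.pos (own r) = r := ha.pos_home (Or.inl rfl)
  have hs : (C.obs G (own r)).me.state = RobotState.root := ha.state_root
  have hb : (C.obs G (own r)).body = ({ C.mem (own r) with
      fullyDispersedPort := ((children G r r).filter fun w =>
        levelCard G r w (knownStage L (k + 1) (G.dist r r)) = 0).card
      fullyDispersed := decide (levelCard G r r (knownStage L (k + 1) (G.dist r r)) = 0) },
      none) := by
    have hcount : (C.mem (own r)).fullyDispersedPort +
        (C.obs G (own r)).here.countP (fun z => z.2 ≠ none ∧ z.1.fullyDispersed = true) =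
        ((children G r r).filter fun w =>
          levelCard G r w (knownStage L (k + 1) (G.dist r r)) = 0).card := by
      rw [C.countP_here, hp, ← h.count_step hG, ha.count]
      congr 2
      ext j
      simpa using h.entered_iff hG hl j
    have hcount' : (C.obs G (own r)).me.fullyDispersedPort +
        (C.obs G (own r)).here.countP (fun z => z.2 ≠ none ∧ z.1.fullyDispersed = true) =
        ((children G r r).filter fun w =>
          levelCard G r w (knownStage L (k + 1) (G.dist r r)) = 0).card := hcount
    have hfull : (C.obs G (own r)).me.fullyDispersed =
        decide (levelCard G r r (knownStage L k (G.dist r r)) = 0) := ha.full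
    have hd : (C.obs G (own r)).deg = (children G r r).card := by
      change G.degree (C.pos (own r)) = _
      rw [hp, degree_root hG]
    rw [Obs.body, hs]
    simp only
    rw [hcount', hfull, hd, decide_levelCard (knownStage_le_succ _ _ _)
      (Or.inr (by rwa [← degree_root hG]))]
    rfl
  have hst := rootedTreeLogN.round_stay P C (i := own r)
    (by rw [act_of_not_stopped ha.stopped, hb])
  rw [hb, hst.1, hst.2]
  exact
    { stopped := ha.stopped
      lvl := ha.lvl
      rnd := ha.rnd
      dist := ha.dist
      state := ha.state
      parentPtr := ha.parentPtr
      entered := ha.entered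
      count := rfl
      full := rfl
      reqd := by simpa using ha.reqd
      pos_up := fun hn => absurd rfl hn
      pos_home := fun _ => hp
      arr_root := fun _ => rfl }

theorem body_settled (hG : G.IsTree) {v : V} (hr : v ≠ r) (ho : Occupied G r L k v)
    (hl : levelCard G r v (L - 1) ≠ 0) :
    ActiveNode P r L k (knownStage L (k + 1) (G.dist r v)) (LeavesUp G r L k v) v
      (C.obs G (own v)).body.1
      ((rootedTreeLogN.round P C).pos (own v)) ((rootedTreeLogN.round P C).arr (own v)) := by
  have ha := h.active v ho hl
  have hs : (C.obs G (own v)).me.state = RobotState.settled := ha.state_settled hr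
  have hadj := parent_adj hG hr
  have hd1 := one_le_dist hG hr
  have hd2 := ho.depth_lt_or hr
  have hd3 := ho.depth_le
  have hup : (C.obs G (own v)).me.GoesUp ↔ LeavesUp G r L k v := ha.goesUp_iff
  have hpar : (C.obs G (own v)).me.AtParent ↔ VisitRound L k (G.dist r v) :=
    ha.atParent_iff hG hr ho
  have hmeme : (C.obs G (own v)).me = C.mem (own v) := rfl
  by_cases hv : VisitRound L k (G.dist r v)
  · obtain ⟨hp, harr⟩ := ha.pos_up hr hv
    have hnu : ¬ (C.obs G (own v)).me.GoesUp := (hpar.2 hv).1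
    have harr' : (C.obs G (own v)).arr = some (P.port (parent G r v) v) := harr
    have hb : (C.obs G (own v)).body =
        ({ C.mem (own v) with portEntered := P.port (parent G r v) v },
          some (P.port (parent G r v) v)) := by
      rw [Obs.body, hs]
      simp only
      rw [if_neg hnu, if_pos (hpar.2 hv), harr']
      rfl
    have hst := rootedTreeLogN.round_cross P C (i := own v) (p := P.port (parent G r v) v)
      (by rw [act_of_not_stopped ha.stopped, hb]) (by rw [hp, P.cross_port hadj])
    have hK : knownStage L (k + 1) (G.dist r v) = knownStage L k (G.dist r v) :=
      knownStage_succ (by unfold VisitRound at hv; omega)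
    rw [hb, hst.1, hst.2, hK]
    exact
      { stopped := ha.stopped
        lvl := ha.lvl
        rnd := ha.rnd
        dist := ha.dist
        state := ha.state
        parentPtr := ha.parentPtr
        entered := P.port_le _ _
        count := ha.count
        full := ha.full
        reqd := ha.reqd
        pos_up := fun _ hu => absurd (hup.2 hu) hnu
        pos_home := fun _ => rfl
        arr_root := fun hn => absurd hn hr }
  · have hp : C.pos (own v) = v := ha.pos_home (Or.inr hv)
    have hdeg : (C.obs G (own v)).deg = (children G r v).card + 1 := by
      change G.degree (C.pos (own v)) = _
      rw [hp, degree_of_ne hG hr]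
    have hc : (C.mem (own v)).fullyDispersedPort +
        (C.obs G (own v)).informers.countP (fun z => z.1.fullyDispersed = true) =
        ((children G r v).filter fun w =>
          levelCard G r w (knownStage L (k + 1) (G.dist r v)) = 0).card := by
      rw [C.countP_informers, hp, ← h.count_step hG, ha.count]
    have hq : (if (C.obs G (own v)).informers.card = 0 then (C.mem (own v)).numRobotsReqd
        else ((C.obs G (own v)).informers.map fun z => z.1.numRobotsReqd).sum) =
        if G.dist r v + 1 = L then levelCard G r v L
          else levelCard G r v (knownStage L (k + 1) (G.dist r v)) := by
      rw [C.card_informers, C.sum_informers, hp]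
      exact h.reqd_step hG hr ho hl
    have hhear : (C.obs G (own v)).hear = { C.mem (own v) with
        fullyDispersedPort := ((children G r v).filter fun w =>
          levelCard G r w (knownStage L (k + 1) (G.dist r v)) = 0).card
        numRobotsReqd := if G.dist r v + 1 = L then levelCard G r v L
          else levelCard G r v (knownStage L (k + 1) (G.dist r v)) } := by
      rw [Obs.hear, hmeme, hc, hq]
    by_cases hu : LeavesUp G r L k v
    · have hptr : (C.obs G (own v)).me.parentPtr = some (P.port v (parent G r v)) := by
        have := ha.parentPtr
        rwa [if_neg hr] at this
      -- In round `d - 1` an assigned node satisfies `d ≤ L - 2`, and in the later departure rounds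
      -- stage `L` is known; so the premature leaf test is excluded.
      have hK : G.dist r v < knownStage L (k + 1) (G.dist r v) := by
        unfold LeavesUp at hu
        unfold knownStage
        split_ifs <;> omega
      have hfull : (C.obs G (own v)).me.fullyDispersed =
          decide (levelCard G r v (knownStage L k (G.dist r v)) = 0) := ha.full
      have hb : (C.obs G (own v)).body = ({ C.mem (own v) with
          fullyDispersedPort := ((children G r v).filter fun w =>
            levelCard G r w (knownStage L (k + 1) (G.dist r v)) = 0).card
          numRobotsReqd := if G.dist r v + 1 = L then levelCard G r v L
            else levelCard G r v (knownStage L (k + 1) (G.dist r v))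
          fullyDispersed := decide (levelCard G r v (knownStage L (k + 1) (G.dist r v)) = 0) },
          some (P.port v (parent G r v))) := by
        rw [Obs.body, hs]
        simp only
        rw [if_pos (hup.2 hu), hhear, hptr, hfull, hdeg]
        simp only [Nat.add_right_cancel_iff]
        rw [decide_levelCard (knownStage_le_succ _ _ _) (Or.inl hK)]
      have hst := rootedTreeLogN.round_cross P C (i := own v) (p := P.port v (parent G r v))
        (by rw [act_of_not_stopped ha.stopped, hb]) (by rw [hp, P.cross_port hadj.symm])
      rw [hb, hst.1, hst.2]
      exact
        { stopped := ha.stopped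
          lvl := ha.lvl
          rnd := ha.rnd
          dist := ha.dist
          state := ha.state
          parentPtr := ha.parentPtr
          entered := ha.entered
          count := rfl
          full := rfl
          reqd := by rw [if_neg hr]
          pos_up := fun _ _ => ⟨rfl, rfl⟩
          pos_home := fun hn => absurd hn (not_or.2 ⟨hr, not_not.2 hu⟩)
          arr_root := fun hn => absurd hn hr }
    · have hK : knownStage L (k + 1) (G.dist r v) = knownStage L k (G.dist r v) :=
        knownStage_succ (by unfold LeavesUp at hu; omega)
      have hb : (C.obs G (own v)).body = ((C.obs G (own v)).hear, none) := by
        rw [Obs.body, hs]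
        simp only
        rw [if_neg (fun h => hu (hup.1 h)), if_neg (fun h => hv (hpar.1 h))]
      have hst := rootedTreeLogN.round_stay P C (i := own v)
        (by rw [act_of_not_stopped ha.stopped, hb])
      rw [hb, hst.1, hst.2, hhear]
      exact
        { stopped := ha.stopped
          lvl := ha.lvl
          rnd := ha.rnd
          dist := ha.dist
          state := ha.state
          parentPtr := ha.parentPtr
          entered := ha.entered
          count := rfl
          full := by rw [hK]; exact ha.full
          reqd := by rw [if_neg hr]
          pos_up := fun _ hn => absurd hn hu
          pos_home := fun _ => hp
          arr_root := fun _ => rfl }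

theorem body_active (hG : G.IsTree) (hdeg : 0 < G.degree r) {v : V} (ho : Occupied G r L k v)
    (hl : levelCard G r v (L - 1) ≠ 0) :
    ActiveNode P r L k (knownStage L (k + 1) (G.dist r v)) (LeavesUp G r L k v) v
      (C.obs G (own v)).body.1
      ((rootedTreeLogN.round P C).pos (own v)) ((rootedTreeLogN.round P C).arr (own v)) := by
  by_cases hr : v = r
  · subst hr
    exact h.body_root hG hdeg ho hl
  · exact h.body_settled hG hr ho hl

end StageInv

end NodeStep

/-! ### Round counters, and the ports assigned to explorers. -/

section FreeStep

variable {V : Type*} [Fintype V] [DecidableEq V] {G : SimpleGraph V} [DecidableRel G.Adj] {n : ℕ}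
  {P : PortNumbering G} {r : V} {lab : Fin n → ℕ} {L k : ℕ} {C : Config n V Mem}
  {own : V → Fin n}

theorem Mem.tick_of_lt {x : Mem} (h : x.rndCntr < 2 * x.lvlCntr + 1) :
    x.tick = { x with rndCntr := x.rndCntr + 1 } := by
  rw [Mem.tick, if_neg h.ne]

theorem Mem.tick_next {x : Mem} (h : x.rndCntr = 2 * x.lvlCntr + 1)
    (hf : x.fullyDispersed = false) :
    x.tick = { x with lvlCntr := x.lvlCntr + 1, rndCntr := 1 } := by
  rw [Mem.tick, if_pos h, if_neg (by simp [hf])]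

theorem Mem.tick_last {x : Mem} (h : x.rndCntr = 2 * x.lvlCntr + 1)
    (hf : x.fullyDispersed = true) :
    x.tick = { x with stopped := true } := by
  rw [Mem.tick, if_pos h, if_pos hf]

theorem Mem.tick_label (x : Mem) : x.tick.label = x.label := by
  unfold Mem.tick
  split_ifs <;> rfl

theorem ActiveNode.tick_of_lt {v p : V} {x : Mem} {a : Option ℕ}
    (h : ActiveNode P r L k (knownStage L (k + 1) (G.dist r v)) (LeavesUp G r L k v) v x p a)
    (hk : k < 2 * L + 1) :
    ActiveNode P r L (k + 1) (knownStage L (k + 1) (G.dist r v))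
      (VisitRound L (k + 1) (G.dist r v)) v x.tick p a := by
  have hup : VisitRound L (k + 1) (G.dist r v) ↔ LeavesUp G r L k v := by
    unfold LeavesUp VisitRound
    constructor
    · rintro (h | h)
      · exact Or.inl h
      · exact Or.inr (Or.inl (by omega))
    · rintro (h | h | h)
      · exact Or.inl h
      · exact Or.inr (by omega)
      · omega
  rw [Mem.tick_of_lt (by rw [h.lvl, h.rnd]; exact hk), hup]
  exact { h with rnd := congrArg (· + 1) h.rnd }

/-- Round 1 of a stage is a visiting round for depth 1, so those robots must leave in the last round
of the preceding stage. This is what the third clause of `Mem.GoesUp` provides. -/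
theorem ActiveNode.tick_next {v p : V} {x : Mem} {a : Option ℕ}
    (h : ActiveNode P r L k (knownStage L (k + 1) (G.dist r v)) (LeavesUp G r L k v) v x p a)
    (hk : k = 2 * L + 1) (ho : Occupied G r L k v) (hl : levelCard G r v L ≠ 0) :
    ActiveNode P r (L + 1) 1 (knownStage (L + 1) 1 (G.dist r v))
      (VisitRound (L + 1) 1 (G.dist r v)) v x.tick p a := by
  have hd := ho.depth_le
  have e1 : knownStage L (k + 1) (G.dist r v) = L := if_pos (by omega)
  have e2 : knownStage (L + 1) 1 (G.dist r v) = L := if_neg (by omega)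
  have hup : VisitRound (L + 1) 1 (G.dist r v) ↔ LeavesUp G r L k v := by
    unfold LeavesUp VisitRound
    constructor
    · rintro (h | h)
      · have e3 : knownStage L k (G.dist r v) = L := if_pos (by omega)
        exact Or.inr (Or.inr ⟨h.symm, hk, by rwa [e3]⟩)
      · omega
    · rintro (h | h | h) <;> omega
  rw [e1] at h
  rw [Mem.tick_next (by rw [h.lvl, h.rnd, hk]) (by rw [h.full]; simpa using hl), hup, e2]
  exact { h with
    rnd := rfl
    lvl := congrArg (· + 1) h.lvl
    reqd := by
      refine h.reqd.trans ?_
      rw [ite_self, if_neg (show ¬ (G.dist r v + 1 = L + 1) by omega)] }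

/-- A robot stops at its own node because the extra departure in round `2L + 1` is reserved for
subtrees that are not full. -/
theorem ActiveNode.tick_last {v p : V} {x : Mem} {a : Option ℕ}
    (h : ActiveNode P r L k (knownStage L (k + 1) (G.dist r v)) (LeavesUp G r L k v) v x p a)
    (hG : G.IsTree) (hk : k = 2 * L + 1) (ho : Occupied G r L k v) (hl : levelCard G r v L = 0)
    (hn : L ≤ Fintype.card V) : StoppedNode v x.tick p := by
  have hd := ho.depth_le
  have e1 : knownStage L (k + 1) (G.dist r v) = L := if_pos (by omega)
  rw [e1] at h
  rw [Mem.tick_last (by rw [h.lvl, h.rnd, hk]) (by rw [h.full]; simpa using hl)]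
  refine ⟨rfl, ?_, ?_, ?_⟩
  · change x.state = _ ∨ x.state = _
    rw [h.state]
    split_ifs <;> simp
  · apply h.pos_home
    right
    unfold LeavesUp
    rintro (h | h | h)
    · omega
    · omega
    · have e3 : knownStage L k (G.dist r v) = L := if_pos (by omega)
      rw [e3] at h
      exact h.2.2 hl
  · constructor
    · exact h.entered
    · change ∀ q ∈ x.parentPtr, _
      rw [h.parentPtr]
      split_ifs
      · simp
      · intro q hq
        rw [Option.mem_some_iff] at hq
        rw [← hq]
        exact P.port_le _ _
    · exact h.dist.trans_le (dist_lt_card hG v).le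
    · exact h.count.trans_le (Finset.card_le_univ _)
    · refine h.reqd.trans_le ?_
      rw [ite_self]
      split_ifs
      · exact (G.degree_lt_card_verts r).le
      · exact levelCard_le_card hG _ _
    · exact (show 1 ≤ L by omega).trans_eq h.lvl.symm
    · exact h.lvl.trans_le (by omega)
    · exact h.rnd.trans_le (by omega)

theorem StoppedNode.round {v : V} {i : Fin n} (h : StoppedNode v (C.mem i) (C.pos i)) :
    StoppedNode v ((rootedTreeLogN.round P C).mem i) ((rootedTreeLogN.round P C).pos i) := by
  have hact := act_of_stopped (G := G) h.stopped
  have hst := rootedTreeLogN.round_stay P C (i := i) (by rw [hact])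
  rw [RobotAlgorithm.round_mem, hact, hst.1]
  exact h

theorem Obs.body_label (o : Obs Mem) : o.body.1.label = o.me.label := by
  unfold Obs.body Obs.furtherExplore Obs.hear
  split
  · rfl
  · dsimp only
    split_ifs
    · split <;> rfl
    · rfl
    · rfl
  · dsimp only
    split_ifs <;> rfl
  · split_ifs <;> rfl

theorem round_label (P : PortNumbering G) (C : Config n V Mem) (i : Fin n) :
    ((rootedTreeLogN.round P C).mem i).label = (C.mem i).label := by
  rw [RobotAlgorithm.round_mem]
  unfold rootedTreeLogN
  simp only
  split_ifs
  · rfl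
  · rw [Mem.tick_label, Obs.body_label]
    rfl

/-- The ports through which the exploring robots at `u` leave in stage `L`, in the order of
increasing labels of the robots. -/
noncomputable def exploreList (P : PortNumbering G) (r : V) (L : ℕ) (u : V) : List ℕ :=
  (List.range (G.degree u)).flatMap fun p =>
    List.replicate (∑ w ∈ children G r u, if P.port u w = p then levelCard G r w (L - 1) else 0) p

theorem length_exploreList {u : V} (hu : G.dist r u + 1 < L) :
    (exploreList P r L u).length = levelCard G r u (L - 1) := by
  rw [exploreList, List.length_flatMap]
  simp only [List.length_replicate]
  rw [List.sum_map_range, Finset.sum_comm, levelCard_eq_sum (by omega)]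
  refine Finset.sum_congr rfl fun w hw => ?_
  rw [Finset.sum_ite_eq, if_pos (Finset.mem_range.2 (P.port_lt (mem_children.1 hw).1))]

theorem sum_children_port {u w : V} (hw : w ∈ children G r u) (f : V → ℕ) :
    (∑ w' ∈ children G r u, if P.port u w' = P.port u w then f w' else 0) = f w := by
  rw [Finset.sum_eq_single w]
  · simp
  · intro w' hw' hne
    rw [if_neg]
    exact fun he => hne (P.port_injOn (mem_children.1 hw').1 (mem_children.1 hw).1 he)
  · exact fun h => absurd hw h

theorem count_exploreList {u w : V} (hw : w ∈ children G r u) :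
    (exploreList P r L u).count (P.port u w) = levelCard G r w (L - 1) := by
  rw [exploreList, List.count_flatMap, List.sum_map_range]
  simp only [Function.comp, List.count_replicate, beq_iff_eq]
  rw [Finset.sum_ite_eq', if_pos (Finset.mem_range.2 (P.port_lt (mem_children.1 hw).1)),
    sum_children_port hw fun w => levelCard G r w (L - 1)]

theorem mem_exploreList {u : V} {p : ℕ} (hp : p ∈ exploreList P r L u) :
    ∃ w ∈ children G r u, P.port u w = p := by
  rw [exploreList, List.mem_flatMap] at hp
  obtain ⟨q, -, hq⟩ := hp
  obtain ⟨h0, rfl⟩ := List.mem_replicate.1 hq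
  obtain ⟨w, hw, hne⟩ := Finset.exists_ne_zero_of_sum_ne_zero h0
  exact ⟨w, hw, by by_contra hc; simp [hc] at hne⟩

/-- The robots that explore from `u`. -/
def explorersAt (C : Config n V Mem) (u : V) : Finset (Fin n) :=
  {i | C.pos i = u ∧ (C.mem i).state = RobotState.explore}

theorem mem_explorersAt {u : V} {i : Fin n} :
    i ∈ explorersAt C u ↔ C.pos i = u ∧ (C.mem i).state = RobotState.explore := by
  simp [explorersAt]

namespace StageInv

variable (h : StageInv P r lab L k C own)
include h

/-- If `d + 2 < L`, some child is visiting, so the port of a silent, full child gets zero robots and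
every other port what its child states. If `d + 2 = L`, no child has a robot, and the default of one
robot per port is the correct value 1. -/
theorem need_child (hG : G.IsTree) {u w : V} (hk : G.dist r u + 1 = k) (hkL : k < L)
    (hl : levelCard G r u (L - 1) ≠ 0) {i : Fin n} (hi : C.pos i = u)
    (hw : w ∈ children G r u) :
    (C.obs G i).need (P.port u w) = levelCard G r w (L - 1) := by
  have ho : Occupied G r L k u := Or.inl (by omega)
  rw [Obs.need, C.countP_here, C.card_informers, C.sum_filter_informers, hi, if_neg]
  · rw [h.card_informing hG, h.sum_informing hG]
    by_cases hd : G.dist r u + 2 < L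
    · have hvis := visitors_eq (G := G) (r := r) (L := L) (k := k) (v := u)
        (Or.inr ⟨hk.symm, hd⟩)
      rw [hvis, if_neg (Finset.card_pos.2 (visitors_nonempty hl hd.le)).ne', ← hvis]
      have h1 : ∀ w' ∈ (children G r u).filter fun w' => Occupied G r L k w' ∧
          levelCard G r w' (L - 1) ≠ 0 ∧ VisitRound L k (G.dist r w'),
          (if C.arr (own w') = some (P.port u w) then (C.mem (own w')).numRobotsReqd else 0) =
          if P.port u w' = P.port u w then levelCard G r w' (L - 1) else 0 := by
        intro w' hw'
        rw [Finset.mem_filter] at hw'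
        have hac := h.active w' hw'.2.1 hw'.2.2.1
        have hK : knownStage L (k + 1) (G.dist r u) = L - 1 := if_neg (by omega)
        rw [h.child_reqd hw'.1 hw'.2.1 hw'.2.2.1 (Or.inr ⟨hk.symm, hd⟩),
          (hac.pos_up (ne_root_of_mem_children hw'.1) hw'.2.2.2).2, parent_eq hG hw'.1, hK]
        simp
      rw [Finset.sum_congr rfl h1, hvis, Finset.sum_filter_of_ne,
        sum_children_port hw fun w => levelCard G r w (L - 1)]
      intro w' _ hne hz
      simp [hz] at hne
    · rw [visitors_eq_empty (by omega), Finset.card_empty, if_pos rfl, levelCard_of_le]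
      rw [(mem_children.1 hw).2]
      omega
  · rw [not_lt, Nat.le_zero, Finset.card_eq_zero, Finset.filter_eq_empty_iff]
    rintro j - ⟨hp, hj, hptr⟩
    obtain ⟨-, rfl⟩ := h.atHome_own hG hp hj
    rw [(h.active u ho hl).parentPtr] at hptr
    split_ifs at hptr with hr
    have := P.port_injOn (parent_adj hG hr).symm (mem_children.1 hw).1 (Option.some.inj hptr)
    exact parent_notMem_children hG hr (this ▸ hw)

theorem need_parent (hG : G.IsTree) {u : V} (hr : u ≠ r) (hk : G.dist r u + 1 = k) (hkL : k < L)
    (hl : levelCard G r u (L - 1) ≠ 0) {i : Fin n} (hi : C.pos i = u) :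
    (C.obs G i).need (P.port u (parent G r u)) = 0 := by
  have ho : Occupied G r L k u := Or.inl (by omega)
  rw [Obs.need, C.countP_here, hi, if_pos]
  rw [Finset.card_pos]
  obtain ⟨h1, h2⟩ := h.own_atHome hG ho hl (Or.inr (by unfold VisitRound; omega))
  refine ⟨own u, Finset.mem_filter.2 ⟨Finset.mem_univ _, h1, h2, ?_⟩⟩
  rw [(h.active u ho hl).parentPtr, if_neg hr]

theorem assignedPort_eq (hG : G.IsTree) {u : V} (hk : G.dist r u + 1 = k) (hkL : k < L)
    (hl : levelCard G r u (L - 1) ≠ 0) {i : Fin n} (hi : C.pos i = u) :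
    (C.obs G i).assignedPort = (exploreList P r L u)[
      ((explorersAt C u).filter fun j => lab j < lab i).card]? := by
  have hlist : ((List.range (C.obs G i).deg).flatMap fun p =>
      List.replicate ((C.obs G i).need p) p) = exploreList P r L u := by
    change ((List.range (G.degree (C.pos i))).flatMap fun p =>
      List.replicate ((C.obs G i).need p) p) = _
    rw [hi, exploreList]
    refine List.flatMap_congr fun p hp => ?_
    congr 1
    obtain ⟨w, hadj, rfl⟩ := P.exists_port (List.mem_range.1 hp)
    rcases adj_cases (r := r) hG hadj with hw | ⟨hr, rfl⟩
    · rw [h.need_child hG hk hkL hl hi hw, sum_children_port hw fun w => levelCard G r w (L - 1)]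
    · rw [h.need_parent hG hr hk hkL hl hi]
      symm
      refine Finset.sum_eq_zero fun w hw => if_neg fun he => ?_
      have := P.port_injOn (mem_children.1 hw).1 hadj he
      exact parent_notMem_children hG hr (this ▸ hw)
  have hrank : (C.obs G i).rank =
      ((explorersAt C u).filter fun j => lab j < lab i).card := by
    rw [Obs.rank, C.countP_here, hi, explorersAt, Finset.filter_filter]
    congr 1
    ext j
    have : (C.obs G i).me.label = lab i := h.label i
    simp only [this, h.label, and_assoc]
  rw [Obs.assignedPort, hlist, hrank]

theorem explore_place {i : Fin n} (hL : 1 ≤ L)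
    (hi : (C.mem i).state = RobotState.explore) :
    G.dist r (C.pos i) + 1 = k ∧ k ≤ L ∧ ((C.pos i = r ∧ C.arr i = none) ∨
      (2 ≤ k ∧ C.arr i = some (P.port (C.pos i) (parent G r (C.pos i))))) := by
  rcases (h.free i (h.state_explore_free hi)).place with ⟨h1, h2, h3⟩ | ⟨h1, h2, h3, -, h4⟩
  · rw [hi] at h3
    split_ifs at h3 with hk
    refine ⟨?_, by omega, Or.inl ⟨h1, h2⟩⟩
    rw [h1, hk, SimpleGraph.dist_self]
  · exact ⟨h3, h2, Or.inr ⟨h1, h4⟩⟩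

theorem entered_le {i : Fin n} (hL : 1 ≤ L) (hi : (C.mem i).state = RobotState.explore) :
    (C.arr i).getD (C.mem i).portEntered ≤ Fintype.card V := by
  rcases (h.explore_place hL hi).2.2 with ⟨-, h1⟩ | ⟨-, h1⟩
  · rw [h1]
    exact (h.free i (h.state_explore_free hi)).entered
  · rw [h1]
    exact P.port_le _ _

/-- At a node from which robots explore, descendants are left at the depth of the stage. -/
theorem levelCard_ne_zero (hL : 1 ≤ L) (hr : levelCard G r r (L - 1) ≠ 0) {i : Fin n}
    (hi : (C.mem i).state = RobotState.explore) : levelCard G r (C.pos i) (L - 1) ≠ 0 := by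
  obtain ⟨h1, h2, ⟨h3, -⟩ | ⟨h3, -⟩⟩ := h.explore_place hL hi
  · rwa [h3]
  · rw [← h.explorers h3 h2 _ h1, ← Nat.pos_iff_ne_zero, Finset.card_pos]
    exact ⟨i, by simp [hi]⟩

end StageInv

end FreeStep

/-! ### Exploring, settling and waiting within a stage. -/

section StageStep

variable {V : Type*} [Fintype V] [DecidableEq V] {G : SimpleGraph V} [DecidableRel G.Adj] {n : ℕ}
  {P : PortNumbering G} {r : V} {lab : Fin n → ℕ} {L k : ℕ} {C : Config n V Mem}
  {own : V → Fin n}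

namespace StageInv

variable (h : StageInv P r lab L k C own)
include h

theorem wait_place {i : Fin n} (hi : (C.mem i).state = RobotState.wait) :
    (∀ v, Occupied G r L k v → own v ≠ i) ∧ C.pos i = r ∧ C.arr i = none ∧ k ≠ 1 := by
  have hf : ∀ v, Occupied G r L k v → own v ≠ i := by
    rintro v hv rfl
    by_cases hl : levelCard G r v (L - 1) = 0
    · have := (h.stopped v hv hl).state
      simp [hi] at this
    · have := (h.active v hv hl).state
      rw [hi] at this
      split_ifs at this
  refine ⟨hf, ?_⟩
  rcases (h.free i hf).place with ⟨h1, h2, h3⟩ | ⟨-, -, -, h3, -⟩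
  · refine ⟨h1, h2, fun hk => ?_⟩
    rw [hi, if_pos hk] at h3
    cases h3
  · rw [hi] at h3
    cases h3

theorem wait_step_lt {i : Fin n} (hi : (C.mem i).state = RobotState.wait) (hk : k < 2 * L + 1)
    (hk1 : 1 ≤ k) :
    ((rootedTreeLogN.round P C).mem i).state = RobotState.wait ∧
    FreeRobot P r L (k + 1) ((rootedTreeLogN.round P C).mem i)
      ((rootedTreeLogN.round P C).pos i) ((rootedTreeLogN.round P C).arr i) := by
  obtain ⟨hf, hp, ha, hk⟩ := h.wait_place hi
  have hfr := h.free i hf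
  have hs : (C.obs G i).me.state = RobotState.wait := hi
  have hb : (C.obs G i).body = (C.mem i, none) := by
    have hne : ¬ ((C.obs G i).me.rndCntr = 2 * (C.obs G i).me.lvlCntr + 1) := by
      change ¬ ((C.mem i).rndCntr = 2 * (C.mem i).lvlCntr + 1)
      rw [hfr.rnd, hfr.lvl]
      omega
    rw [Obs.body, hs]
    dsimp only
    rw [if_neg hne]
    rfl
  have hact := act_of_not_stopped (G := G) hfr.stopped
  have hst := rootedTreeLogN.round_stay P C (i := i) (by rw [hact, hb])
  rw [RobotAlgorithm.round_mem, hact, hb, hst.1, hst.2]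
  dsimp only
  rw [Mem.tick_of_lt (by rw [hfr.lvl, hfr.rnd]; omega)]
  refine ⟨hi, { hfr with rnd := congrArg (· + 1) hfr.rnd, place := Or.inl ⟨hp, rfl, ?_⟩ }⟩
  rw [if_neg (by omega)]
  exact hi

theorem wait_step_end {i : Fin n} (hi : (C.mem i).state = RobotState.wait) (hk : k = 2 * L + 1) :
    FreeRobot P r (L + 1) 1 ((rootedTreeLogN.round P C).mem i)
      ((rootedTreeLogN.round P C).pos i) ((rootedTreeLogN.round P C).arr i) := by
  obtain ⟨hf, hp, ha, -⟩ := h.wait_place hi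
  have hfr := h.free i hf
  have hs : (C.obs G i).me.state = RobotState.wait := hi
  have hb : (C.obs G i).body = ({ C.mem i with state := RobotState.explore }, none) := by
    have hne : ((C.obs G i).me.rndCntr = 2 * (C.obs G i).me.lvlCntr + 1) := by
      change ((C.mem i).rndCntr = 2 * (C.mem i).lvlCntr + 1)
      rw [hfr.rnd, hfr.lvl, hk]
    rw [Obs.body, hs]
    dsimp only
    rw [if_pos hne]
    rfl
  have hact := act_of_not_stopped (G := G) hfr.stopped
  have hst := rootedTreeLogN.round_stay P C (i := i) (by rw [hact, hb])
  rw [RobotAlgorithm.round_mem, hact, hb, hst.1, hst.2]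
  dsimp only
  rw [Mem.tick_next (x := { C.mem i with state := RobotState.explore })
    (by dsimp only; rw [hfr.lvl, hfr.rnd, hk]) hfr.full]
  exact { hfr with rnd := rfl, lvl := congrArg (· + 1) hfr.lvl, place := Or.inl ⟨hp, rfl, rfl⟩ }

theorem body_explore {i : Fin n} (hG : G.IsTree) (hL : 1 ≤ L) (hr : levelCard G r r (L - 1) ≠ 0)
    (hi : (C.mem i).state = RobotState.explore) (ho : Occupied G r L k (C.pos i)) :
    (C.obs G i).body = if k < L then
        (C.obs G i).furtherExplore
          { C.mem i with portEntered := (C.arr i).getD (C.mem i).portEntered }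
      else ({ C.mem i with
        portEntered := (C.arr i).getD (C.mem i).portEntered
        state := RobotState.wait }, none) := by
  have hs : (C.obs G i).me.state = RobotState.explore := hi
  have hfr := h.free i (h.state_explore_free hi)
  have hpl := h.explore_place hL hi
  have hhome : 0 < (C.obs G i).here.countP fun z => z.1.AtHome := by
    rw [C.countP_here, Finset.card_pos]
    -- Explorers in round `k` are at depth `k - 1 < L`, for which round `k` is not a visiting round;
    -- the robot assigned there is at home.
    obtain ⟨h1, h2⟩ := h.own_atHome hG ho (h.levelCard_ne_zero hL hr hi) (by
      by_cases hrt : C.pos i = r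
      · exact Or.inl hrt
      · right
        unfold VisitRound
        omega)
    exact ⟨own (C.pos i), Finset.mem_filter.2 ⟨Finset.mem_univ _, h1, h2⟩⟩
  rw [Obs.body, hs]
  dsimp only
  rw [if_pos hhome]
  have hc : (C.mem i).rndCntr < (C.mem i).lvlCntr ↔ k < L := by
    rw [hfr.lvl, hfr.rnd]
  exact if_congr hc rfl rfl

theorem explore_step_move {i : Fin n} (hG : G.IsTree) (hL : 1 ≤ L)
    (hr : levelCard G r r (L - 1) ≠ 0) (hkL : k < L)
    (hi : (C.mem i).state = RobotState.explore) {w : V} (hw : w ∈ children G r (C.pos i))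
    (ha : (exploreList P r L (C.pos i))[
      ((explorersAt C (C.pos i)).filter fun j => lab j < lab i).card]? =
        some (P.port (C.pos i) w)) :
    ((rootedTreeLogN.round P C).mem i).state = RobotState.explore ∧
    (rootedTreeLogN.round P C).pos i = w ∧
    FreeRobot P r L (k + 1) ((rootedTreeLogN.round P C).mem i)
      ((rootedTreeLogN.round P C).pos i) ((rootedTreeLogN.round P C).arr i) := by
  have hfr := h.free i (h.state_explore_free hi)
  have hpl := h.explore_place hL hi
  have hmc := mem_children.1 hw
  rw [← h.assignedPort_eq hG hpl.1 hkL (h.levelCard_ne_zero hL hr hi) rfl] at ha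
  have hb := h.body_explore hG hL hr hi (Or.inl (by omega))
  rw [if_pos hkL, Obs.furtherExplore, ha] at hb
  dsimp only at hb
  have hact := act_of_not_stopped (G := G) hfr.stopped
  have hst := rootedTreeLogN.round_cross P C (i := i) (p := P.port (C.pos i) w)
    (by rw [hact, hb]) (P.cross_port hmc.1)
  rw [RobotAlgorithm.round_mem, hact, hb, hst.1, hst.2]
  dsimp only
  rw [Mem.tick_of_lt (by dsimp only; rw [hfr.lvl, hfr.rnd]; omega)]
  refine ⟨hi, rfl, { hfr with
    rnd := congrArg (· + 1) hfr.rnd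
    dist := ?_
    entered := h.entered_le hL hi
    place := Or.inr ⟨by omega, by omega, by omega, hi, by rw [parent_eq hG hw]⟩ }⟩
  change (C.mem i).distFromRoot + 1 = _
  rw [hfr.dist, hmc.2]

theorem explore_step_rest {i : Fin n} (hG : G.IsTree) (hL : 1 ≤ L)
    (hr : levelCard G r r (L - 1) ≠ 0) (hkL : k < L)
    (hi : (C.mem i).state = RobotState.explore) (hp : C.pos i = r)
    (ha : (exploreList P r L (C.pos i))[
      ((explorersAt C (C.pos i)).filter fun j => lab j < lab i).card]? = none) :
    ((rootedTreeLogN.round P C).mem i).state = RobotState.wait ∧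
    FreeRobot P r L (k + 1) ((rootedTreeLogN.round P C).mem i)
      ((rootedTreeLogN.round P C).pos i) ((rootedTreeLogN.round P C).arr i) := by
  have hfr := h.free i (h.state_explore_free hi)
  have hpl := h.explore_place hL hi
  rw [← h.assignedPort_eq hG hpl.1 hkL (h.levelCard_ne_zero hL hr hi) rfl] at ha
  have hb := h.body_explore hG hL hr hi (Or.inl (by omega))
  rw [if_pos hkL, Obs.furtherExplore, ha] at hb
  dsimp only at hb
  have hact := act_of_not_stopped (G := G) hfr.stopped
  have hst := rootedTreeLogN.round_stay P C (i := i) (by rw [hact, hb])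
  rw [RobotAlgorithm.round_mem, hact, hb, hst.1, hst.2]
  dsimp only
  rw [Mem.tick_of_lt (by dsimp only; rw [hfr.lvl, hfr.rnd]; omega)]
  refine ⟨rfl, { hfr with
    rnd := congrArg (· + 1) hfr.rnd
    entered := h.entered_le hL hi
    place := Or.inl ⟨hp, rfl, ?_⟩ }⟩
  rw [if_neg (by omega)]

theorem explore_step_first {i : Fin n} (hG : G.IsTree)
    (hr : levelCard G r r (L - 1) ≠ 0) (hL : L = 1)
    (hi : (C.mem i).state = RobotState.explore) :
    ((rootedTreeLogN.round P C).mem i).state = RobotState.wait ∧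
    FreeRobot P r L (k + 1) ((rootedTreeLogN.round P C).mem i)
      ((rootedTreeLogN.round P C).pos i) ((rootedTreeLogN.round P C).arr i) := by
  have hfr := h.free i (h.state_explore_free hi)
  have hpl := h.explore_place hL.ge hi
  have hp : C.pos i = r := by
    rw [← dist_root_eq_zero_iff hG]
    omega
  have hb := h.body_explore hG hL.ge hr hi (by rw [hp]; exact occupied_root hL.ge)
  rw [if_neg (by omega)] at hb
  have hact := act_of_not_stopped (G := G) hfr.stopped
  have hst := rootedTreeLogN.round_stay P C (i := i) (by rw [hact, hb])
  rw [RobotAlgorithm.round_mem, hact, hb, hst.1, hst.2]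
  dsimp only
  rw [Mem.tick_of_lt (by dsimp only; rw [hfr.lvl, hfr.rnd]; omega)]
  refine ⟨rfl, { hfr with
    rnd := congrArg (· + 1) hfr.rnd
    entered := h.entered_le hL.ge hi
    place := Or.inl ⟨hp, rfl, ?_⟩ }⟩
  rw [if_neg (by omega)]

/-- The initial values of a settled robot already fit: for stage `L - 1` the node and its children
have value 1, so the flag is false and the counter zero, and the number of children is the value for
level `L`. -/
theorem settle_step {i : Fin n} (hG : G.IsTree) (hL : 2 ≤ L) (hk : k = L)
    (hi : (C.mem i).state = RobotState.explore) :
    ActiveNode P r L (k + 1) (knownStage L (k + 1) (G.dist r (C.pos i)))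
      (VisitRound L (k + 1) (G.dist r (C.pos i))) (C.pos i)
      ((rootedTreeLogN.round P C).mem i) ((rootedTreeLogN.round P C).pos i)
      ((rootedTreeLogN.round P C).arr i) := by
  have hs : (C.obs G i).me.state = RobotState.explore := hi
  have hfr := h.free i (h.state_explore_free hi)
  have hpl := h.explore_place (by omega) hi
  have hr : C.pos i ≠ r := by
    rw [Ne, ← dist_root_eq_zero_iff hG]
    omega
  have harr : C.arr i = some (P.port (C.pos i) (parent G r (C.pos i))) := by
    rcases hpl.2.2 with h1 | h1
    · exact absurd h1.1 hr
    · exact h1.2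
  have hhome : (C.obs G i).here.countP (fun z => z.1.AtHome) = 0 := by
    rw [C.countP_here, Finset.card_eq_zero, Finset.filter_eq_empty_iff]
    rintro j - ⟨hp, hj⟩
    have := (h.atHome_own hG hp hj).1.depth_lt_or hr
    omega
  have hb : (C.obs G i).body = ({ C.mem i with
      portEntered := P.port (C.pos i) (parent G r (C.pos i))
      state := RobotState.settled
      numRobotsReqd := (children G r (C.pos i)).card
      parentPtr := some (P.port (C.pos i) (parent G r (C.pos i))) }, none) := by
    have hdeg : (C.obs G i).deg - 1 = (children G r (C.pos i)).card := by
      change G.degree (C.pos i) - 1 = _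
      rw [degree_of_ne hG hr, Nat.add_sub_cancel]
    have harr' : (C.obs G i).arr = some (P.port (C.pos i) (parent G r (C.pos i))) := harr
    rw [Obs.body, hs]
    dsimp only
    rw [if_neg (by omega), hdeg, harr']
    rfl
  have hact := act_of_not_stopped (G := G) hfr.stopped
  have hst := rootedTreeLogN.round_stay P C (i := i) (by rw [hact, hb])
  have hK : knownStage L (k + 1) (G.dist r (C.pos i)) = L - 1 := if_neg (by omega)
  rw [RobotAlgorithm.round_mem, hact, hb, hst.1, hst.2, hK]
  dsimp only
  rw [Mem.tick_of_lt (by dsimp only; rw [hfr.lvl, hfr.rnd]; omega)]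
  exact
    { stopped := hfr.stopped
      lvl := hfr.lvl
      rnd := congrArg (· + 1) hfr.rnd
      dist := hfr.dist
      state := by rw [if_neg hr]
      parentPtr := by rw [if_neg hr]
      entered := P.port_le _ _
      count := by
        refine hfr.count.trans ?_
        symm
        rw [Finset.card_eq_zero, Finset.filter_eq_empty_iff]
        intro w hw
        rw [levelCard_of_le]
        · simp
        · have := (mem_children.1 hw).2
          omega
      full := by
        refine hfr.full.trans ?_
        rw [levelCard_of_le (by omega)]
        rfl
      reqd := by
        rw [if_neg hr, if_pos (by omega), levelCard_eq_sum (by omega), Finset.card_eq_sum_ones]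
        refine Finset.sum_congr rfl fun w hw => (levelCard_of_le ?_).symm
        have := (mem_children.1 hw).2
        omega
      pos_up := fun _ hv => by
        unfold VisitRound at hv
        omega
      pos_home := fun _ => rfl
      arr_root := fun hn => absurd hn hr }

theorem owned_active {v : V} (hG : G.IsTree) (hdeg : 0 < G.degree r) (hk : k < 2 * L + 1)
    (ho : Occupied G r L k v) (hl : levelCard G r v (L - 1) ≠ 0) :
    ActiveNode P r L (k + 1) (knownStage L (k + 1) (G.dist r v))
      (VisitRound L (k + 1) (G.dist r v)) v ((rootedTreeLogN.round P C).mem (own v))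
      ((rootedTreeLogN.round P C).pos (own v)) ((rootedTreeLogN.round P C).arr (own v)) := by
  have := (h.body_active hG hdeg ho hl).tick_of_lt hk
  rwa [RobotAlgorithm.round_mem, act_of_not_stopped (h.active v ho hl).stopped]

theorem owned_stopped {v : V} (ho : Occupied G r L k v) (hl : levelCard G r v (L - 1) = 0) :
    StoppedNode v ((rootedTreeLogN.round P C).mem (own v))
      ((rootedTreeLogN.round P C).pos (own v)) :=
  (h.stopped v ho hl).round

theorem owned_not_explore {v : V} (hG : G.IsTree) (hdeg : 0 < G.degree r) (hk : k < 2 * L + 1)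
    (ho : Occupied G r L k v) :
    ((rootedTreeLogN.round P C).mem (own v)).state ≠ RobotState.explore := by
  by_cases hl : levelCard G r v (L - 1) = 0
  · rcases (h.owned_stopped ho hl).state with h1 | h1 <;> simp [h1]
  · rw [(h.owned_active hG hdeg hk ho hl).state]
    split_ifs <;> simp

theorem label_round (i : Fin n) : ((rootedTreeLogN.round P C).mem i).label = lab i := by
  rw [round_label, h.label]

/-- There are as many robots as nodes, and the nodes at depth `L - 1` have none assigned yet. Hence
the unassigned robots, all exploring at the root in round 1, suffice for them. -/
theorem card_explorersAt_root (hG : G.IsTree) (hn : Fintype.card V = n) (hk : k = 1)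
    (hkL : k < L) : levelCard G r r (L - 1) ≤ (explorersAt C r).card := by
  have hsub : Finset.univ \ ((Finset.univ.filter fun v => Occupied G r L k v).image own) ⊆
      explorersAt C r := by
    intro i hi
    simp only [Finset.mem_sdiff, Finset.mem_univ, true_and, Finset.mem_image, Finset.mem_filter,
      not_exists, not_and] at hi
    rcases (h.free i hi).place with ⟨h1, -, h2⟩ | ⟨h1, -⟩
    · exact mem_explorersAt.2 ⟨h1, by rw [h2, if_pos hk]⟩
    · omega
  refine le_trans ?_ (Finset.card_le_card hsub)
  have h1 := Finset.le_card_sdiff ((Finset.univ.filter fun v => Occupied G r L k v).image own)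
    (Finset.univ : Finset (Fin n))
  have h2 : ((Finset.univ.filter fun v => Occupied G r L k v).image own).card ≤
    (Finset.univ.filter fun v => Occupied G r L k v).card := Finset.card_image_le
  have h3 : (Finset.univ.filter fun v => G.dist r v = L - 1).card +
      (Finset.univ.filter fun v => Occupied G r L k v).card ≤ n := by
    rw [← hn, ← Finset.card_union_of_disjoint]
    · exact Finset.card_le_univ _
    · rw [Finset.disjoint_filter]
      rintro v - hv (ho | ⟨-, ho | ho⟩)
      · omega
      · omega
      · rw [ho, SimpleGraph.dist_self] at hv
        omega
  rw [levelCard_root hG]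
  rw [Finset.card_univ, Fintype.card_fin] at h1
  omega

theorem length_le_card_explorersAt (hG : G.IsTree) (hn : Fintype.card V = n) {u : V} 
    (hu : G.dist r u + 1 = k) (hkL : k < L) :
    (exploreList P r L u).length ≤ (explorersAt C u).card ∧
      (u ≠ r → (explorersAt C u).card = (exploreList P r L u).length) := by
  rw [length_exploreList (by omega)]
  by_cases hr : u = r
  · subst hr
    rw [SimpleGraph.dist_self] at hu
    exact ⟨h.card_explorersAt_root hG hn hu.symm hkL, fun hn => absurd rfl hn⟩
  · have := one_le_dist hG hr
    have h1 : (explorersAt C u).card = levelCard G r u (L - 1) :=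
      h.explorers (by omega) hkL.le u hu
    exact ⟨h1.ge, fun _ => h1⟩

/-- No explorer is stranded below the root: there the list of ports is as long as the number of
explorers, so every rank hits an entry. -/
theorem explore_step (hG : G.IsTree) (hn : Fintype.card V = n) (hlab : Function.Injective lab)
    (hk1 : 1 ≤ k) (hkL : k < L) {i : Fin n}
    (hi : (C.mem i).state = RobotState.explore) :
    (∃ w ∈ children G r (C.pos i), (exploreList P r L (C.pos i))[
      ((explorersAt C (C.pos i)).filter fun j => lab j < lab i).card]? =
        some (P.port (C.pos i) w)) ∨
    (C.pos i = r ∧ (exploreList P r L (C.pos i))[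
      ((explorersAt C (C.pos i)).filter fun j => lab j < lab i).card]? = none) := by
  have hpl := h.explore_place (by omega) hi
  cases ha : (exploreList P r L (C.pos i))[
      ((explorersAt C (C.pos i)).filter fun j => lab j < lab i).card]? with
  | some p =>
    left
    obtain ⟨w, hw, rfl⟩ := mem_exploreList (List.mem_of_getElem? ha)
    exact ⟨w, hw, rfl⟩
  | none =>
    right
    refine ⟨?_, rfl⟩
    by_contra hne
    have hlen := (h.length_le_card_explorersAt hG hn hpl.1 hkL).2 hne
    rw [List.getElem?_eq_none_iff, ← hlen] at ha
    have hmem : ((explorersAt C (C.pos i)).filter fun j => lab j < lab i).card ∈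
        Finset.range (explorersAt C (C.pos i)).card := by
      rw [← image_rank _ lab hlab.injOn]
      exact Finset.mem_image_of_mem _ (mem_explorersAt.2 ⟨rfl, hi⟩)
    have := Finset.mem_range.1 hmem
    omega

theorem step_explore (hG : G.IsTree) (hn : Fintype.card V = n) (hlab : Function.Injective lab)
    (hdeg : 0 < G.degree r) (hk1 : 1 ≤ k) (hr : levelCard G r r (L - 1) ≠ 0) (hkL : k < L) :
    StageInv P r lab L (k + 1) (rootedTreeLogN.round P C) own := by
  have hocc : ∀ v, Occupied G r L (k + 1) v ↔ Occupied G r L k v := by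
    intro v
    unfold Occupied
    constructor
    · rintro (h1 | ⟨h1, h2 | h2⟩)
      · exact Or.inl h1
      · omega
      · exact Or.inr ⟨h1, Or.inr h2⟩
    · rintro (h1 | ⟨h1, h2 | h2⟩)
      · exact Or.inl h1
      · omega
      · exact Or.inr ⟨h1, Or.inr h2⟩
  refine
    { label := h.label_round
      inj := fun v w hv hw => h.inj v w ((hocc v).1 hv) ((hocc w).1 hw)
      active := fun v hv hl => h.owned_active hG hdeg (by omega) ((hocc v).1 hv) hl
      stopped := fun v hv hl => h.owned_stopped ((hocc v).1 hv) hl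
      free := ?_
      explorers := ?_ }
  · intro i hi
    have hf : ∀ v, Occupied G r L k v → own v ≠ i := fun v hv => hi v ((hocc v).2 hv)
    rcases (h.free i hf).state_cases with hs | hs
    · rcases h.explore_step hG hn hlab hk1 hkL hs with ⟨w, hw, ha⟩ | ⟨hp, ha⟩
      · exact (h.explore_step_move hG (by omega) hr hkL hs hw ha).2.2
      · exact (h.explore_step_rest hG (by omega) hr hkL hs hp ha).2
    · exact (h.wait_step_lt hs (by omega) hk1).2
  · intro _ _ w hw
    have hwr : w ≠ r := by
      rintro rfl
      rw [SimpleGraph.dist_self] at hw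
      omega
    have hwc := mem_children_parent hG hwr
    have hdu : G.dist r (parent G r w) + 1 = k := by
      have := dist_parent hG hwr
      omega
    obtain ⟨hlen, -⟩ := h.length_le_card_explorersAt hG hn hdu hkL
    -- The explorers arriving at `w` should be those at its parent whose rank selects the port
    -- towards `w`; their number is the multiplicity of that port.
    rw [← count_exploreList hwc, ← card_filter_getElem?_rank _ lab hlab.injOn _ hlen]
    congr 1
    ext i
    simp only [Finset.mem_filter, Finset.mem_univ, true_and, mem_explorersAt]
    constructor
    · rintro ⟨hp, hs⟩
      rcases owner_or_free (G := G) own r L k i with ⟨v, hv, rfl⟩ | hf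
      · exact absurd hs (h.owned_not_explore hG hdeg (by omega) hv)
      · rcases (h.free i hf).state_cases with hs' | hs'
        · rcases h.explore_step hG hn hlab hk1 hkL hs' with ⟨w', hw', ha⟩ | ⟨hp', ha⟩
          · have hm := (h.explore_step_move hG (by omega) hr hkL hs' hw' ha).2.1
            obtain rfl : w' = w := hm.symm.trans hp
            have hu := parent_eq hG hw'
            rw [hu]
            exact ⟨⟨rfl, hs'⟩, ha⟩
          · rw [(h.explore_step_rest hG (by omega) hr hkL hs' hp' ha).1] at hs
            cases hs
        · rw [(h.wait_step_lt hs' (by omega) hk1).1] at hs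
          cases hs
    · rintro ⟨⟨hp, hs⟩, ha⟩
      rw [← hp] at hwc ha
      have := h.explore_step_move hG (by omega) hr hkL hs hwc ha
      exact ⟨this.2.1, this.1⟩

theorem step_wait (hG : G.IsTree) (hdeg : 0 < G.degree r) (hk1 : 1 ≤ k)
    (hkL : L < k) (hk : k < 2 * L + 1) :
    StageInv P r lab L (k + 1) (rootedTreeLogN.round P C) own := by
  have hocc : ∀ v, Occupied G r L (k + 1) v ↔ Occupied G r L k v := by
    intro v
    have h1 : L < k + 1 := by omega
    simp [Occupied, hkL, h1]
  refine
    { label := h.label_round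
      inj := fun v w hv hw => h.inj v w ((hocc v).1 hv) ((hocc w).1 hw)
      active := fun v hv hl => h.owned_active hG hdeg (by omega) ((hocc v).1 hv) hl
      stopped := fun v hv hl => h.owned_stopped ((hocc v).1 hv) hl
      free := ?_
      explorers := by omega }
  intro i hi
  have hf : ∀ v, Occupied G r L k v → own v ≠ i := fun v hv => hi v ((hocc v).2 hv)
  rcases (h.free i hf).place with ⟨-, -, hs⟩ | ⟨h1, h2, -⟩
  · rcases (h.free i hf).state_cases with hs' | hs'
    · rw [hs'] at hs
      split_ifs at hs with h1
      have := (h.free i hf).lvl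
      omega
    · exact (h.wait_step_lt hs' hk hk1).2
  · omega

end StageInv

end StageStep

/-! ### Whole stages, termination and the round bound. -/

section Run

variable {V : Type*} [Fintype V] [DecidableEq V] {G : SimpleGraph V} [DecidableRel G.Adj] {n : ℕ}
  {P : PortNumbering G} {r : V} {lab : Fin n → ℕ} {L k : ℕ} {C : Config n V Mem}
  {own : V → Fin n}

namespace StageInv

/-- In stage 1 the only node to be filled is the root, which received its robot in the
initialisation; the others merely start to wait. -/
theorem step_first (h : StageInv P r lab 1 1 C own) (hG : G.IsTree) (hdeg : 0 < G.degree r)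
    (hr : levelCard G r r 0 ≠ 0) :
    StageInv P r lab 1 2 (rootedTreeLogN.round P C) own := by
  have hocc : ∀ v, Occupied G r 1 2 v ↔ Occupied G r 1 1 v := by
    intro v
    have := dist_root_eq_zero_iff hG (r := r) (v := v)
    simp [Occupied, this]
  refine
    { label := h.label_round
      inj := fun v w hv hw => h.inj v w ((hocc v).1 hv) ((hocc w).1 hw)
      active := fun v hv hl => h.owned_active hG hdeg (by omega) ((hocc v).1 hv) hl
      stopped := fun v hv hl => h.owned_stopped ((hocc v).1 hv) hl
      free := ?_
      explorers := by omega }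
  intro i hi
  have hf : ∀ v, Occupied G r 1 1 v → own v ≠ i := fun v hv => hi v ((hocc v).2 hv)
  rcases (h.free i hf).state_cases with hs | hs
  · exact (h.explore_step_first hG hr rfl hs).2
  · exact (h.wait_step_lt hs (by omega) le_rfl).2

theorem step_settle (h : StageInv P r lab L L C own) (hG : G.IsTree) (hdeg : 0 < G.degree r)
    (hL : 2 ≤ L) : ∃ own', StageInv P r lab L (L + 1) (rootedTreeLogN.round P C) own' := by
  -- At depth `L - 1` the number of explorers is `levelCard G r v (L - 1) = 1`; this single robot
  -- becomes the owner, and shallower nodes keep theirs.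
  have hex : ∀ v, ∃ j, (G.dist r v + 1 = L → explorersAt C v = {j}) ∧
      (G.dist r v + 1 ≠ L → j = own v) := by
    intro v
    by_cases hv : G.dist r v + 1 = L
    · have h1 : (explorersAt C v).card = levelCard G r v (L - 1) := h.explorers hL le_rfl v hv
      rw [levelCard_of_le (by omega), Finset.card_eq_one] at h1
      obtain ⟨j, hj⟩ := h1
      exact ⟨j, fun _ => hj, fun hn => absurd hv hn⟩
    · exact ⟨own v, fun hn => absurd hn hv, fun _ => rfl⟩
  choose own' hnew hold using hex
  have hmem : ∀ v, G.dist r v + 1 = L →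
      C.pos (own' v) = v ∧ (C.mem (own' v)).state = RobotState.explore := by
    intro v hv
    rw [← mem_explorersAt, hnew v hv]
    exact Finset.mem_singleton_self _
  have hocc : ∀ v, Occupied G r L (L + 1) v → G.dist r v + 1 ≠ L → Occupied G r L L v := by
    rintro v (hv | hv) hne
    · exact Or.inl hv
    · exact absurd hv.1 hne
  have hlev : ∀ v, G.dist r v + 1 = L → levelCard G r v (L - 1) ≠ 0 := by
    intro v hv
    rw [levelCard_of_le (by omega)]
    exact one_ne_zero
  refine ⟨own',
    { label := h.label_round
      inj := ?_
      active := ?_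
      stopped := ?_
      free := ?_
      explorers := by omega }⟩
  · intro v w hv hw he
    by_cases hv1 : G.dist r v + 1 = L <;> by_cases hw1 : G.dist r w + 1 = L
    · rw [← (hmem v hv1).1, ← (hmem w hw1).1, he]
    · have h1 := h.state_explore_free (hmem v hv1).2 w (hocc w hw hw1)
      rw [he, hold w hw1] at h1
      exact absurd rfl h1
    · have h1 := h.state_explore_free (hmem w hw1).2 v (hocc v hv hv1)
      rw [← he, hold v hv1] at h1
      exact absurd rfl h1
    · rw [hold v hv1, hold w hw1] at he
      exact h.inj v w (hocc v hv hv1) (hocc w hw hw1) he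
  · intro v hv hl
    by_cases hv1 : G.dist r v + 1 = L
    · obtain ⟨h1, h2⟩ := hmem v hv1
      have := h.settle_step hG hL rfl h2
      rwa [h1] at this
    · rw [hold v hv1]
      exact h.owned_active hG hdeg (by omega) (hocc v hv hv1) hl
  · intro v hv hl
    by_cases hv1 : G.dist r v + 1 = L
    · exact absurd hl (hlev v hv1)
    · rw [hold v hv1]
      exact h.owned_stopped (hocc v hv hv1) hl
  · intro i hi
    have hf : ∀ v, Occupied G r L L v → own v ≠ i := by
      intro v hv
      have hv1 : G.dist r v + 1 ≠ L := by
        rcases hv with hv | ⟨hv, hv' | rfl⟩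
        · omega
        · omega
        · rw [SimpleGraph.dist_self] at hv
          omega
      rw [← hold v hv1]
      refine hi v (Or.inl ?_)
      have := Occupied.depth_le hv
      omega
    rcases (h.free i hf).state_cases with hs | hs
    · exfalso
      have hpl := (h.explore_place (by omega) hs).1
      have hm : i ∈ explorersAt C (C.pos i) := mem_explorersAt.2 ⟨rfl, hs⟩
      rw [hnew _ hpl, Finset.mem_singleton] at hm
      exact hi (C.pos i) (Or.inr ⟨hpl, Or.inl (Nat.lt_succ_self L)⟩) hm.symm
    · exact (h.wait_step_lt hs (by omega) (by omega)).2

theorem step_end (h : StageInv P r lab L k C own) (hG : G.IsTree) (hdeg : 0 < G.degree r)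
    (hL : 1 ≤ L) (hk : k = 2 * L + 1) (hn : L ≤ Fintype.card V) :
    StageInv P r lab (L + 1) 1 (rootedTreeLogN.round P C) own := by
  have hocc : ∀ v, Occupied G r (L + 1) 1 v ↔ Occupied G r L k v := by
    intro v
    have hd : v = r → G.dist r v = 0 := (dist_root_eq_zero_iff hG).2
    unfold Occupied
    constructor
    · rintro (hv | ⟨hv, hv' | hv'⟩)
      · omega
      · omega
      · have := hd hv'
        omega
    · rintro (hv | ⟨hv, -⟩) <;> exact Or.inl (by omega)
  refine
    { label := h.label_round
      inj := fun v w hv hw => h.inj v w ((hocc v).1 hv) ((hocc w).1 hw)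
      active := ?_
      stopped := ?_
      free := ?_
      explorers := by omega }
  · intro v hv hl
    rw [Nat.add_sub_cancel] at hl
    have ho := (hocc v).1 hv
    have hl' : levelCard G r v (L - 1) ≠ 0 :=
      fun hz => hl (levelCard_eq_zero_of_le (Nat.sub_le L 1) hz)
    have := (h.body_active hG hdeg ho hl').tick_next hk ho hl
    rwa [RobotAlgorithm.round_mem, act_of_not_stopped (h.active v ho hl').stopped]
  · intro v hv hl
    rw [Nat.add_sub_cancel] at hl
    have ho := (hocc v).1 hv
    by_cases hl' : levelCard G r v (L - 1) = 0
    · exact h.owned_stopped ho hl'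
    · have := (h.body_active hG hdeg ho hl').tick_last hG hk ho hl hn
      rwa [RobotAlgorithm.round_mem, act_of_not_stopped (h.active v ho hl').stopped]
  · intro i hi
    have hf : ∀ v, Occupied G r L k v → own v ≠ i := fun v hv => hi v ((hocc v).2 hv)
    refine h.wait_step_end ?_ hk
    rcases (h.free i hf).place with ⟨-, -, hs⟩ | ⟨-, h2, -⟩
    · rw [hs, if_neg (by omega)]
    · omega

theorem step (h : StageInv P r lab L k C own) (hG : G.IsTree) (hn : Fintype.card V = n)
    (hlab : Function.Injective lab) (hdeg : 0 < G.degree r) (hr : levelCard G r r (L - 1) ≠ 0)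
    (hL : 1 ≤ L) (hk1 : 1 ≤ k) (hk : k < 2 * L + 1) :
    ∃ own', StageInv P r lab L (k + 1) (rootedTreeLogN.round P C) own' := by
  rcases lt_trichotomy k L with hkL | rfl | hkL
  · exact ⟨own, h.step_explore hG hn hlab hdeg hk1 hr hkL⟩
  · rcases hL.eq_or_lt with rfl | hL2
    · exact ⟨own, h.step_first hG hdeg hr⟩
    · exact h.step_settle hG hdeg hL2
  · exact ⟨own, h.step_wait hG hdeg hk1 hkL hk⟩

end StageInv

theorem dist_lt_of_levelCard_root_eq_zero (hG : G.IsTree) {H : ℕ} (hH : levelCard G r r H = 0)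
    (v : V) : G.dist r v < H := by
  by_contra hv
  have h1 := levelCard_eq_zero_of_le (not_lt.1 hv) hH
  rw [levelCard_root hG, Finset.card_eq_zero, Finset.filter_eq_empty_iff] at h1
  exact h1 (Finset.mem_univ v) rfl

theorem levelCard_eq_zero_of_root (hG : G.IsTree) {H : ℕ} (hH : levelCard G r r H = 0)
    (v : V) : levelCard G r v H = 0 := by
  have := levelCard_le_root hG (dist_lt_of_levelCard_root_eq_zero hG hH v).le
  omega

namespace StageInv

variable {H : ℕ}

theorem final_occupied (hG : G.IsTree) (hH : levelCard G r r H = 0) (v : V) :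
    Occupied G r (H + 1) k v :=
  Or.inl (Nat.succ_lt_succ (dist_lt_of_levelCard_root_eq_zero hG hH v))

theorem final_bijective (h : StageInv P r lab (H + 1) 1 C own) (hG : G.IsTree)
    (hn : Fintype.card V = n) (hH : levelCard G r r H = 0) : Function.Bijective own := by
  rw [Fintype.bijective_iff_injective_and_card]
  exact ⟨fun v w he => h.inj v w (final_occupied hG hH v) (final_occupied hG hH w) he, by simp [hn]⟩

theorem final_stopped (h : StageInv P r lab (H + 1) 1 C own) (hG : G.IsTree)
    (hH : levelCard G r r H = 0) (v : V) :
    StoppedNode v (C.mem (own v)) (C.pos (own v)) :=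
  h.stopped v (final_occupied hG hH v) (levelCard_eq_zero_of_root hG hH v)

/-- When level `H` is empty, the invariant for round 1 of stage `H + 1` concerns stopped robots
only. It therefore persists without advancing the stage or the round. -/
theorem final_step (h : StageInv P r lab (H + 1) 1 C own) (hG : G.IsTree)
    (hn : Fintype.card V = n) (hH : levelCard G r r H = 0) :
    StageInv P r lab (H + 1) 1 (rootedTreeLogN.round P C) own :=
  { label := h.label_round
    inj := h.inj
    active := fun v _ hl => absurd (levelCard_eq_zero_of_root hG hH v) hl
    stopped := fun v _ _ => (h.final_stopped hG hH v).round
    free := fun i hi => by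
      obtain ⟨v, rfl⟩ := (h.final_bijective hG hn hH).2 i
      exact absurd rfl (hi v (final_occupied hG hH v))
    explorers := by omega }

theorem dispersed (h : StageInv P r lab (H + 1) 1 C own) (hG : G.IsTree)
    (hn : Fintype.card V = n) (hH : levelCard G r r H = 0) :
    C.Dispersed ∧ ∀ i, (C.mem i).stopped = true := by
  have hb := h.final_bijective hG hn hH
  constructor
  · intro v
    refine ⟨own v, (h.final_stopped hG hH v).pos, fun i hi => ?_⟩
    obtain ⟨w, rfl⟩ := hb.2 i
    rw [← (h.final_stopped hG hH w).pos, ← hi]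
  · intro i
    obtain ⟨v, rfl⟩ := hb.2 i
    exact (h.final_stopped hG hH v).stopped

theorem small (h : StageInv P r lab L k C own) (hG : G.IsTree) (hL1 : 1 ≤ L) (hL : L ≤ Fintype.card V + 1)
    (hk : k ≤ 2 * L + 1) (i : Fin n) : (C.mem i).Small (Fintype.card V) := by
  rcases owner_or_free (G := G) own r L k i with ⟨v, hv, rfl⟩ | hf
  · by_cases hl : levelCard G r v (L - 1) = 0
    · exact (h.stopped v hv hl).small
    · have ha := h.active v hv hl
      constructor
      · exact ha.entered
      · rw [ha.parentPtr]
        split_ifs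
        · simp
        · intro q hq
          rw [Option.mem_some_iff] at hq
          rw [← hq]
          exact P.port_le _ _
      · exact ha.dist.trans_le (dist_lt_card hG v).le
      · exact ha.count.trans_le (Finset.card_le_univ _)
      · refine ha.reqd.trans_le ?_
        split_ifs
        · exact (G.degree_lt_card_verts r).le
        · exact levelCard_le_card hG _ _
        · exact levelCard_le_card hG _ _
      · exact hL1.trans_eq ha.lvl.symm
      · exact ha.lvl.trans_le hL
      · exact ha.rnd.trans_le (by omega)
  · have ha := h.free i hf
    constructor
    · exact ha.entered
    · rw [ha.parentPtr]
      simp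
    · exact ha.dist.trans_le (dist_lt_card hG _).le
    · exact ha.count.trans_le (Nat.zero_le _)
    · exact ha.reqd.trans_le (Nat.zero_le _)
    · exact hL1.trans_eq ha.lvl.symm
    · exact ha.lvl.trans_le hL
    · exact ha.rnd.trans_le (by omega)

end StageInv

section Setup

variable (r lab)

theorem setup_mem (i : Fin n) :
    (rootedTreeLogN.run P r lab 0).mem i =
      if ∀ j, lab i ≤ lab j then
        { rootedTreeLogN.fresh (lab i) with
          lvlCntr := 1
          rndCntr := 1
          state := RobotState.root
          numRobotsReqd := G.degree r
          fullyDispersed := decide (G.degree r = 0)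
          stopped := decide (G.degree r = 0) }
      else { rootedTreeLogN.fresh (lab i) with lvlCntr := 1, rndCntr := 1 } := by
  have hiff : (∀ z ∈ ((rootedTreeLogN.freshConfig r lab).obs G i).here,
      ((rootedTreeLogN.freshConfig r lab).obs G i).me.label ≤ z.1.label) ↔
      ∀ j, lab i ≤ lab j := by
    simp [Config.obs, RobotAlgorithm.freshConfig, rootedTreeLogN]
  change rootedTreeLogN.setup ((rootedTreeLogN.freshConfig r lab).obs G i) = _
  unfold rootedTreeLogN at hiff ⊢
  exact if_congr hiff rfl rfl

end Setup

theorem setup_inv (hn : Fintype.card V = n) (hlab : Function.Injective lab)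
    (hdeg : 0 < G.degree r) : ∃ own, StageInv P r lab 1 1 (rootedTreeLogN.run P r lab 0) own := by
  have hpos : 0 < n := hn ▸ Fintype.card_pos_iff.2 ⟨r⟩
  have : Nonempty (Fin n) := ⟨⟨0, hpos⟩⟩
  obtain ⟨i₀, hi₀⟩ := Finite.exists_min lab
  have hocc : ∀ v, Occupied G r 1 1 v → v = r := by
    rintro v (hv | ⟨hv, hv' | hv'⟩)
    · omega
    · omega
    · exact hv'
  -- Only the root is assigned at this time, so a constant ownership map by the robot with the
  -- lowest label is good enough.
  refine ⟨fun _ => i₀,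
    { label := ?_
      inj := fun v w hv hw _ => (hocc v hv).trans (hocc w hw).symm
      active := ?_
      stopped := ?_
      free := ?_
      explorers := by omega }⟩
  · intro i
    rw [setup_mem]
    split_ifs <;> rfl
  · intro v hv hl
    obtain rfl := hocc v hv
    have hK : knownStage 1 1 (G.dist v v) = 0 := by
      rw [SimpleGraph.dist_self]
      rfl
    rw [setup_mem, if_pos hi₀, hK]
    constructor
    · exact decide_eq_false hdeg.ne'
    · rfl
    · rfl
    · exact SimpleGraph.dist_self.symm
    · simp
    · simp [rootedTreeLogN]
    · exact Nat.zero_le _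
    · symm
      change _ = 0
      rw [Finset.card_eq_zero, Finset.filter_eq_empty_iff]
      intro w _
      rw [levelCard_of_le (Nat.zero_le _)]
      exact one_ne_zero
    · rw [levelCard_of_le (Nat.zero_le _)]
      exact decide_eq_false hdeg.ne'
    · simp
    · exact fun hn => absurd rfl hn
    · exact fun _ => rfl
    · exact fun _ => rfl
  · intro v _ hl
    rw [levelCard_of_le (Nat.zero_le _)] at hl
    omega
  · intro i hi
    have hne : i₀ ≠ i := hi r (occupied_root le_rfl)
    have hnot : ¬ ∀ j, lab i ≤ lab j := by
      intro hall
      exact hne (hlab (le_antisymm (hi₀ i) (hall i₀)))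
    rw [setup_mem, if_neg hnot]
    exact
      { stopped := rfl
        lvl := rfl
        rnd := rfl
        dist := SimpleGraph.dist_self.symm
        parentPtr := rfl
        entered := Nat.zero_le _
        count := rfl
        full := rfl
        reqd := rfl
        place := Or.inl ⟨rfl, rfl, rfl⟩ }

/-- A single node satisfies the final invariant with `H = 1` at time 0, without any round of stage
1. -/
theorem setup_inv_single (hG : G.IsTree) (hn : Fintype.card V = n) (hdeg : G.degree r = 0) :
    levelCard G r r 1 = 0 ∧
      ∃ own, StageInv P r lab 2 1 (rootedTreeLogN.run P r lab 0) own := by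
  have hz : levelCard G r r 1 = 0 := by
    have := degree_root (r := r) hG
    rw [hdeg] at this
    rw [levelCard_eq_sum (by simp), Finset.card_eq_zero.1 this.symm, Finset.sum_empty]
  have hsub : ∀ v, v = r := fun v => by
    have := dist_lt_of_levelCard_root_eq_zero hG hz v
    rw [← dist_root_eq_zero_iff hG]
    omega
  have hcard : n = 1 := by
    rw [← hn, Fintype.card_eq_one_iff]
    exact ⟨r, hsub⟩
  subst hcard
  refine ⟨hz, fun _ => 0,
    { label := ?_
      inj := fun v w _ _ _ => (hsub v).trans (hsub w).symm
      active := fun v _ hl => absurd (levelCard_eq_zero_of_root hG hz v) hl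
      stopped := ?_
      free := fun i hi => absurd (Subsingleton.elim _ _)
        (hi r (occupied_root (by omega)))
      explorers := by omega }⟩
  · intro i
    rw [setup_mem]
    split_ifs <;> rfl
  · intro v _ _
    rw [setup_mem, if_pos fun j => by rw [Subsingleton.elim j 0]]
    refine ⟨decide_eq_true hdeg, Or.inl rfl, (hsub v).symm, ?_⟩
    constructor <;> simp [rootedTreeLogN, hdeg, hn]

/-- At all times, the configuration is that of some round of some stage or the final one. -/
theorem run_inv (hG : G.IsTree) (hn : Fintype.card V = n) (hlab : Function.Injective lab)
    {H : ℕ} (hH : levelCard G r r H = 0) (hlt : ∀ L < H, levelCard G r r L ≠ 0) (t : ℕ) :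
    (0 < G.degree r ∧ ∃ L k own, 1 ≤ L ∧ L ≤ H ∧ 1 ≤ k ∧ k ≤ 2 * L + 1 ∧ t + 2 = L * L + k ∧
      StageInv P r lab L k (rootedTreeLogN.run P r lab t) own) ∨
    ∃ own, StageInv P r lab (H + 1) 1 (rootedTreeLogN.run P r lab t) own := by
  have hH1 : 1 ≤ H := by
    have := dist_lt_of_levelCard_eq_zero hH
    omega
  have hHn : H ≤ Fintype.card V := by
    by_contra hc
    exact hlt _ (not_le.1 hc) (levelCard_root_card hG)
  induction t with
  | zero =>
    rcases Nat.eq_zero_or_pos (G.degree r) with hdeg | hdeg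
    · right
      obtain ⟨hz, own, h⟩ := setup_inv_single (P := P) (lab := lab) hG hn hdeg
      have : H = 1 := by
        by_contra hc
        exact hlt 1 (by omega) hz
      subst this
      exact ⟨own, h⟩
    · left
      obtain ⟨own, h⟩ := setup_inv (P := P) hn hlab hdeg
      exact ⟨hdeg, 1, 1, own, le_rfl, hH1, le_rfl, by omega, by omega, h⟩
  | succ t ih =>
    rcases ih with ⟨hdeg, L, k, own, hL1, hLH, hk1, hk, ht, h⟩ | ⟨own, h⟩
    · have hr := hlt (L - 1) (by omega)
      rcases hk.lt_or_eq with hk | hk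
      · left
        obtain ⟨own', h'⟩ := h.step hG hn hlab hdeg hr hL1 hk1 hk
        exact ⟨hdeg, L, k + 1, own', hL1, hLH, by omega, by omega, by omega, h'⟩
      -- The clock `t + 2 = L * L + k` passes to the next stage because `L² + (2L + 1) = (L + 1)²`.
      · have h' := h.step_end hG hdeg hL1 hk (hLH.trans hHn)
        rcases hLH.lt_or_eq with hLH | rfl
        · exact Or.inl ⟨hdeg, L + 1, 1, own, by omega, hLH, le_rfl, by omega,
            by rw [hk] at ht; linarith, h'⟩
        · exact Or.inr ⟨own, h'⟩
    · exact Or.inr ⟨own, h.final_step hG hn hH⟩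

theorem exists_height (hG : G.IsTree) (r : V) :
    ∃ H, levelCard G r r H = 0 ∧ (∀ L < H, levelCard G r r L ≠ 0) ∧ H ≤ Fintype.card V := by
  have hex : ∃ H, levelCard G r r H = 0 := ⟨_, levelCard_root_card hG⟩
  classical
  exact ⟨Nat.find hex, Nat.find_spec hex, fun L hL => Nat.find_min hex hL,
    Nat.find_min' hex (levelCard_root_card hG)⟩

/-- Before the final configuration, `t ≤ (L + 1)² - 2` with `L ≤ D + 1`, which is less than `8 D²`
because a root of positive degree forces `D ≥ 1`. -/
theorem run_dispersed (hG : G.IsTree) (hn : Fintype.card V = n) (hlab : Function.Injective lab)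
    {t : ℕ} (ht : 8 * G.diam ^ 2 ≤ t) :
    (rootedTreeLogN.run P r lab t).Dispersed ∧
      ∀ i, ((rootedTreeLogN.run P r lab t).mem i).stopped = true := by
  obtain ⟨H, hH, hlt, -⟩ := exists_height hG r
  rcases run_inv (P := P) hG hn hlab hH hlt t with ⟨hdeg, L, k, own, hL1, hLH, hk1, hk, he, -⟩ |
    ⟨own, h⟩
  · exfalso
    have : Nonempty V := ⟨r⟩
    have hdiam : ∀ v, G.dist r v ≤ G.diam := fun v =>
      SimpleGraph.dist_le_diam (SimpleGraph.connected_iff_ediam_ne_top.1 hG.connected)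
    have h1 : 1 ≤ G.diam := by
      obtain ⟨w, hw⟩ := (G.degree_pos_iff_exists_adj r).1 hdeg
      exact (SimpleGraph.dist_eq_one_iff_adj.2 hw).symm.trans_le (hdiam w)
    have h2 : H ≤ G.diam + 1 := by
      by_contra hc
      have h3 := hlt _ (not_le.1 hc)
      rw [levelCard_root hG, Finset.card_ne_zero] at h3
      obtain ⟨v, hv⟩ := h3
      have h4 := (Finset.mem_filter.1 hv).2
      have h5 := hdiam v
      omega
    have h3 : L ≤ G.diam + 1 := hLH.trans h2
    nlinarith
  · exact h.dispersed hG hn hH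

theorem run_label_small (hG : G.IsTree) (hn : Fintype.card V = n) (hlab : Function.Injective lab)
    (t : ℕ) (i : Fin n) : ((rootedTreeLogN.run P r lab t).mem i).label = lab i ∧
      ((rootedTreeLogN.run P r lab t).mem i).Small n := by
  obtain ⟨H, hH, hlt, hHn⟩ := exists_height hG r
  rcases run_inv (P := P) hG hn hlab hH hlt t with ⟨hdeg, L, k, own, hL1, hLH, hk1, hk, he, h⟩ |
    ⟨own, h⟩
  · exact ⟨h.label i, hn ▸ h.small hG hL1 (by omega) hk i⟩
  · exact ⟨h.label i, hn ▸ h.small hG (by omega) (by omega) (by omega) i⟩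

end Run

/-! ### Changing the representation of memory states. -/

section Transfer

variable {W W' : Type*}

/-- The robot `K` with memory states encoded by `e` and decoded by `d`. -/
def MemoryRobot.transfer (K : MemoryRobot W) (e : W → W') (d : W' → W) : MemoryRobot W' where
  ask w := K.ask (d w)
  next w deg arr rep :=
    (K.next (d w) deg arr (rep.map (Prod.map d id))).map e (Prod.map e id)

/-- A local computation of `K` that passes through memory states in `T` only. -/
inductive MemoryRobot.ComputesWithin (K : MemoryRobot W) (T : Set W) (deg : ℕ) (arr : Option ℕ)
    (reply : ℕ → Option (W × Option ℕ)) : W → W × Option ℕ → Prop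
  | finish {w : W} {out : W × Option ℕ} (hw : w ∈ T)
      (h : K.next w deg arr (reply (K.ask w)) = Sum.inr out) : ComputesWithin K T deg arr reply w out
  | step {w w' : W} {out : W × Option ℕ} (hw : w ∈ T)
      (h : K.next w deg arr (reply (K.ask w)) = Sum.inl w')
      (h' : ComputesWithin K T deg arr reply w' out) : ComputesWithin K T deg arr reply w out

/-- Encoding is faithful on `T` only, so both the states passed through and the replies of other
robots must lie in `T`. -/
theorem MemoryRobot.ComputesWithin.transfer {K : MemoryRobot W} {T : Set W} {deg : ℕ}
    {arr : Option ℕ} {reply : ℕ → Option (W × Option ℕ)} {w : W} {out : W × Option ℕ}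
    {e : W → W'} {d : W' → W} (hT : ∀ w ∈ T, d (e w) = w)
    (hr : ∀ q, ∀ z ∈ reply q, z.1 ∈ T) (h : K.ComputesWithin T deg arr reply w out) :
    (K.transfer e d).Computes deg arr (fun q => (reply q).map (Prod.map e id)) (e w)
      (e out.1, out.2) := by
  have hrep : ∀ q, ((reply q).map (Prod.map e id)).map (Prod.map d id) = reply q := by
    intro q
    cases hq : reply q with
    | none => rfl
    | some z =>
      have := hT z.1 (hr q z hq)
      simp [Prod.map, this]
  have hnext : ∀ w ∈ T, (K.transfer e d).next (e w) deg arr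
      ((reply ((K.transfer e d).ask (e w))).map (Prod.map e id)) =
      (K.next w deg arr (reply (K.ask w))).map e (Prod.map e id) := by
    intro w hw
    simp only [MemoryRobot.transfer]
    rw [hT w hw, hrep]
  induction h with
  | finish hw h =>
    refine .finish ?_
    rw [hnext _ hw, h]
    rfl
  | step hw h h' ih =>
    refine .step ?_ ih
    rw [hnext _ hw, h]
    rfl

end Transfer

/-! ### Local computations expressed through nine sums. -/

section Sums

theorem Multiset.countP_eq_sum_map {α : Type*} (p : α → Prop) [DecidablePred p] (s : Multiset α) :
    s.countP p = (s.map fun z => if p z then 1 else 0).sum := by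
  induction s using Multiset.induction_on with
  | empty => simp
  | cons a s ih => rw [Multiset.countP_cons, ih, Multiset.map_cons, Multiset.sum_cons, add_comm]

theorem Multiset.sum_map_filter {α : Type*} (p : α → Prop) [DecidablePred p] (f : α → ℕ)
    (s : Multiset α) :
    ((s.filter p).map f).sum = (s.map fun z => if p z then f z else 0).sum := by
  induction s using Multiset.induction_on with
  | empty => simp
  | cons a s ih =>
    rw [Multiset.filter_cons, Multiset.map_add, Multiset.sum_add, ih, Multiset.map_cons,
      Multiset.sum_cons]
    split_ifs <;> simp

/-- Block `q` occupies the positions between consecutive prefix sums. A robot can therefore find its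
port from its rank and a running sum, without storing the list. -/
theorem getElem?_flatMap_replicate (f : ℕ → ℕ) {d q k : ℕ} (hq : q < d)
    (h1 : ∑ i ∈ Finset.range q, f i ≤ k) (h2 : k < ∑ i ∈ Finset.range (q + 1), f i) :
    ((List.range d).flatMap fun i => List.replicate (f i) i)[k]? = some q := by
  have hlen : ∀ d, ((List.range d).flatMap fun i => List.replicate (f i) i).length =
      ∑ i ∈ Finset.range d, f i := by
    intro d
    rw [List.length_flatMap]
    simp only [List.length_replicate]
    rw [List.sum_map_range]
  induction d with
  | zero => omega
  | succ d ih =>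
    rw [List.range_succ, List.flatMap_append]
    rcases (Nat.lt_succ_iff.1 hq).lt_or_eq with hq' | rfl
    · rw [List.getElem?_append_left, ih hq']
      rw [hlen]
      exact h2.trans_le (Finset.sum_le_sum_of_subset (Finset.range_mono hq'))
    · rw [List.getElem?_append_right (by rwa [hlen]), hlen]
      rw [Finset.sum_range_succ] at h2
      simp only [List.flatMap_singleton]
      rw [List.getElem?_replicate, if_pos (by omega)]

/-- What a co-located robot contributes to the sums that a robot with memory `x` computes when it
considers the port `p`. -/
def contribution (x : Mem) (p : ℕ) (z : Mem × Option ℕ) : Fin 9 → ℕ :=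
  ![if x.label ≤ z.1.label then 0 else 1,
    if z.2 ≠ none ∧ z.1.fullyDispersed = true then 1 else 0,
    if z.1.AtHome then 1 else 0,
    if z.1.AtHome ∧ z.1.parentPtr = some p then 1 else 0,
    if z.1.Informs then 1 else 0,
    if z.1.fullyDispersed = true ∧ z.1.Informs then 1 else 0,
    if z.1.Informs then z.1.numRobotsReqd else 0,
    if z.2 = some p ∧ z.1.Informs then z.1.numRobotsReqd else 0,
    if z.1.state = RobotState.explore ∧ z.1.label < x.label then 1 else 0]

theorem contribution_le (x : Mem) (p : ℕ) (z : Mem × Option ℕ) (k : Fin 9) :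
    contribution x p z k ≤ max 1 z.1.numRobotsReqd := by
  fin_cases k <;> simp [contribution] <;> split_ifs <;> simp

/-- The sums over all co-located robots. -/
def Obs.sums (o : Obs Mem) (p : ℕ) : Fin 9 → ℕ :=
  fun k => (o.here.map fun z => contribution o.me p z k).sum

variable (o : Obs Mem) (p : ℕ)

theorem Obs.sums_zero : o.sums p 0 = 0 ↔ ∀ z ∈ o.here, o.me.label ≤ z.1.label := by
  have h : ∀ z : Mem × Option ℕ,
      contribution o.me p z 0 = 0 ↔ o.me.label ≤ z.1.label := by
    intro z
    change (if o.me.label ≤ z.1.label then 0 else 1) = 0 ↔ _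
    split_ifs with h <;> simp [h]
  rw [Obs.sums, Multiset.sum_eq_zero_iff, Multiset.forall_mem_map_iff]
  exact forall₂_congr fun z _ => h z

theorem Obs.sums_one :
    o.sums p 1 = o.here.countP fun z => z.2 ≠ none ∧ z.1.fullyDispersed = true := by
  rw [Multiset.countP_eq_sum_map]
  rfl

theorem Obs.sums_two : o.sums p 2 = o.here.countP fun z => z.1.AtHome := by
  rw [Multiset.countP_eq_sum_map]
  rfl

theorem Obs.sums_three :
    o.sums p 3 = o.here.countP fun z => z.1.AtHome ∧ z.1.parentPtr = some p := by
  rw [Multiset.countP_eq_sum_map]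
  rfl

theorem Obs.sums_four : o.sums p 4 = o.informers.card := by
  rw [Obs.informers, ← Multiset.countP_eq_card_filter, Multiset.countP_eq_sum_map]
  rfl

theorem Obs.sums_five :
    o.sums p 5 = o.informers.countP fun z => z.1.fullyDispersed = true := by
  rw [Obs.informers, Multiset.countP_filter, Multiset.countP_eq_sum_map]
  rfl

theorem Obs.sums_six : o.sums p 6 = (o.informers.map fun z => z.1.numRobotsReqd).sum := by
  rw [Obs.informers, Multiset.sum_map_filter]
  rfl

theorem Obs.sums_seven : o.sums p 7 =
    ((o.informers.filter fun z => z.2 = some p).map fun z => z.1.numRobotsReqd).sum := by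
  rw [Obs.informers, Multiset.filter_filter, Multiset.sum_map_filter]
  rfl

theorem Obs.sums_eight : o.sums p 8 = o.rank := by
  rw [Obs.rank, Multiset.countP_eq_sum_map]
  rfl

/-- The number of robots that go through a port, from the sums for this port. -/
def needOfSums (S : Fin 9 → ℕ) : ℕ := if 0 < S 3 then 0 else if S 4 = 0 then 1 else S 7

theorem Obs.needOfSums_sums : needOfSums (o.sums p) = o.need p := by
  rw [needOfSums, Obs.need, o.sums_three, o.sums_four, o.sums_seven]

/-- `Obs.hear`, from the sums. -/
def hearOfSums (x : Mem) (S : Fin 9 → ℕ) : Mem :=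
  { x with
    fullyDispersedPort := x.fullyDispersedPort + S 5
    numRobotsReqd := if S 4 = 0 then x.numRobotsReqd else S 6 }

theorem Obs.hearOfSums_sums : hearOfSums o.me (o.sums p) = o.hear := by
  rw [hearOfSums, Obs.hear, o.sums_four, o.sums_five, o.sums_six]

/-- `Obs.body`, from the sums and the assigned port. -/
def bodyOfSums (x : Mem) (deg : ℕ) (arr : Option ℕ) (S : Fin 9 → ℕ) (a : Option ℕ) :
    Mem × Option ℕ :=
  match x.state with
  | RobotState.root =>
    ({ x with
        fullyDispersedPort := x.fullyDispersedPort + S 1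
        fullyDispersed := x.fullyDispersed || decide (x.fullyDispersedPort + S 1 = deg) }, none)
  | RobotState.explore =>
    if 0 < S 2 then
      if x.rndCntr < x.lvlCntr then
        match a with
        | some p => ({ x with
            portEntered := arr.getD x.portEntered
            distFromRoot := x.distFromRoot + 1 }, some p)
        | none => ({ x with
            portEntered := arr.getD x.portEntered
            state := RobotState.wait }, none)
      else ({ x with portEntered := arr.getD x.portEntered, state := RobotState.wait }, none)
    else
      ({ x with
          portEntered := arr.getD x.portEntered
          state := RobotState.settled
          numRobotsReqd := deg - 1
          parentPtr := some (arr.getD x.portEntered) }, none)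
  | RobotState.wait =>
    (if x.rndCntr = 2 * x.lvlCntr + 1 then { x with state := RobotState.explore } else x, none)
  | RobotState.settled =>
    if x.GoesUp then
      ({ hearOfSums x S with
          fullyDispersed :=
            x.fullyDispersed || decide ((hearOfSums x S).fullyDispersedPort + 1 = deg) },
        x.parentPtr)
    else if x.AtParent then
      ({ x with portEntered := arr.getD x.portEntered }, some (arr.getD x.portEntered))
    else (hearOfSums x S, none)

theorem Obs.bodyOfSums_sums :
    bodyOfSums o.me o.deg o.arr (o.sums p) o.assignedPort = o.body := by
  unfold bodyOfSums Obs.body Obs.furtherExplore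
  rw [o.hearOfSums_sums, o.sums_one, o.sums_two]

/-- The outcome of the local computation, from the sums and the assigned port. -/
def outcomeOfSums (x : Mem) (deg : ℕ) (arr : Option ℕ) (S : Fin 9 → ℕ) (a : Option ℕ) :
    Mem × Option ℕ :=
  if x.lvlCntr = 0 then
    (if S 0 = 0 then
      { x with
        lvlCntr := 1
        rndCntr := 1
        state := RobotState.root
        numRobotsReqd := deg
        fullyDispersed := decide (deg = 0)
        stopped := decide (deg = 0) }
    else { x with lvlCntr := 1, rndCntr := 1 }, none)
  else if x.stopped then (x, none)
  else ((bodyOfSums x deg arr S a).1.tick, (bodyOfSums x deg arr S a).2)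

/-- The stage counter is zero only before the initialisation, so the same machine can tell
initialisation and rounds apart. -/
theorem Obs.outcome_setup (h : o.me.lvlCntr = 0) (a : Option ℕ) :
    outcomeOfSums o.me o.deg o.arr (o.sums p) a = (rootedTreeLogN.setup o, none) := by
  rw [outcomeOfSums, if_pos h]
  exact congrArg (·, none) (if_congr (o.sums_zero p) rfl rfl)

theorem Obs.outcome_act (h : o.me.lvlCntr ≠ 0) :
    outcomeOfSums o.me o.deg o.arr (o.sums p) o.assignedPort = rootedTreeLogN.act o := by
  rw [outcomeOfSums, if_neg h, o.bodyOfSums_sums]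
  rfl

theorem Obs.assignedPort_eq_some {q : ℕ} (hq : q < o.deg)
    (h1 : ∑ i ∈ Finset.range q, o.need i ≤ o.rank)
    (h2 : o.rank < ∑ i ∈ Finset.range (q + 1), o.need i) : o.assignedPort = some q :=
  getElem?_flatMap_replicate o.need hq h1 h2

theorem Obs.assignedPort_eq_none (h : ∑ i ∈ Finset.range o.deg, o.need i ≤ o.rank) :
    o.assignedPort = none := by
  rw [Obs.assignedPort, List.getElem?_eq_none_iff, List.length_flatMap]
  simp only [List.length_replicate]
  rwa [List.sum_map_range]

end Sums

/-! ### The machine that sweeps through all labels. -/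

section Machine

/-- The memory during a local computation: the memory at the beginning of the round, the port that
is considered, the number of robots that go through smaller ports, the label that is addressed next
and the sums over the robots with smaller labels. -/
abbrev Work : Type := Mem × ℕ × ℕ × ℕ × (Fin 9 → ℕ)

/-- The memory at the beginning of a local computation. -/
def Mem.idle (x : Mem) : Work := (x, 0, 0, 0, 0)

/-- After the sums for a port have been computed: continue with the next port, or finish. -/
def nextPort (x : Mem) (p m deg : ℕ) (arr : Option ℕ) (S : Fin 9 → ℕ) :
    Work ⊕ (Work × Option ℕ) :=
  if p < deg then
    if S 8 < m + needOfSums S then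
      Sum.inr ((outcomeOfSums x deg arr S (some p)).map Mem.idle id)
    else Sum.inl (x, p + 1, m + needOfSums S, 0, 0)
  else Sum.inr ((outcomeOfSums x deg arr S none).map Mem.idle id)

/-- The robot that addresses all labels up to `N`, once for each port. -/
def sweepRobot (N : ℕ) : MemoryRobot Work where
  ask w := w.2.2.2.1
  next w deg arr rep :=
    let S : Fin 9 → ℕ := fun k =>
      w.2.2.2.2 k + rep.elim 0 fun z => contribution w.1 w.2.1 (z.1.1, z.2) k
    if w.2.2.2.1 < N then Sum.inl (w.1, w.2.1, w.2.2.1, w.2.2.2.1 + 1, S)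
    else nextPort w.1 w.2.1 w.2.2.1 deg arr S

/-- All numbers in the memory are less than `Q`. -/
structure Mem.Below (Q : ℕ) (x : Mem) : Prop where
  label : x.label < Q
  entered : x.portEntered < Q
  ptr : ∀ q ∈ x.parentPtr, q < Q
  dist : x.distFromRoot < Q
  count : x.fullyDispersedPort < Q
  reqd : x.numRobotsReqd < Q
  lvl : x.lvlCntr < Q
  rnd : x.rndCntr < Q

/-- All numbers in the memory are less than `Q`, during a local computation. -/
def boundedWork (Q : ℕ) : Set Work :=
  {w | w.1.Below Q ∧ w.2.1 < Q ∧ w.2.2.1 < Q ∧ w.2.2.2.1 < Q ∧ ∀ k, w.2.2.2.2 k < Q}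

theorem Mem.Below.idle_mem {Q : ℕ} {x : Mem} (h : x.Below Q) : x.idle ∈ boundedWork Q :=
  have hQ : 0 < Q := (Nat.zero_le _).trans_lt h.label
  ⟨h, hQ, hQ, hQ, fun _ => hQ⟩

variable {V : Type*} [DecidableEq V] {G : SimpleGraph V} [G.LocallyFinite] {n N : ℕ}
  {lab : Fin n → ℕ} {C : Config n V Mem}

theorem Config.reply_eq (hlab : Function.Injective lab) {i j : Fin n} (e : Mem → Work)
    (hj : C.pos j = C.pos i) : C.reply lab e i (lab j) = some (e (C.mem j), C.arr j) := by
  have : ((List.finRange n).find? fun j' => decide (C.pos j' = C.pos i ∧ lab j' = lab j)) =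
      some j := by
    cases hf : (List.finRange n).find? fun j' => decide (C.pos j' = C.pos i ∧ lab j' = lab j) with
    | none =>
      rw [List.find?_eq_none] at hf
      have := hf j (List.mem_finRange j)
      simp [hj] at this
    | some j' =>
      have := List.find?_some hf
      simp only [decide_eq_true_eq] at this
      rw [hlab this.2]
  rw [Config.reply, this]
  rfl

theorem Config.reply_cases (i : Fin n) (q : ℕ) (e : Mem → Work) :
    C.reply lab e i q = none ∨ ∃ j, C.pos j = C.pos i ∧ lab j = q ∧
      C.reply lab e i q = some (e (C.mem j), C.arr j) := by
  cases hf : (List.finRange n).find? fun j' => decide (C.pos j' = C.pos i ∧ lab j' = q) with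
  | none => exact Or.inl (by rw [Config.reply, hf]; rfl)
  | some j =>
    right
    have := List.find?_some hf
    simp only [decide_eq_true_eq] at this
    exact ⟨j, this.1, this.2, by rw [Config.reply, hf]; rfl⟩

/-- Labels are distinct, so each co-located robot replies to exactly one of the labels up to `N`,
and unused labels contribute zero. -/
theorem Config.sum_reply (hlab : Function.Injective lab) (hN : ∀ i, lab i ≤ N) (i : Fin n)
    (f : Mem × Option ℕ → ℕ) :
    ∑ q ∈ Finset.range (N + 1), (C.reply lab Mem.idle i q).elim 0 (fun z => f (z.1.1, z.2)) =
      ((C.obs G i).here.map f).sum := by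
  rw [C.sum_here]
  have hsub : ((Finset.univ.filter fun j => C.pos j = C.pos i).image lab) ⊆
      Finset.range (N + 1) := by
    intro q hq
    obtain ⟨j, -, rfl⟩ := Finset.mem_image.1 hq
    exact Finset.mem_range.2 (Nat.lt_succ_of_le (hN j))
  rw [← Finset.sum_subset hsub, Finset.sum_image hlab.injOn]
  · refine Finset.sum_congr rfl fun j hj => ?_
    rw [C.reply_eq hlab _ (Finset.mem_filter.1 hj).2]
    rfl
  · intro q _ hq
    rcases C.reply_cases (lab := lab) i q Mem.idle with h | ⟨j, h1, h2, -⟩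
    · rw [h]
      rfl
    · exact absurd (Finset.mem_image.2 ⟨j, by simp [h1], h2⟩) hq

end Machine

/-! ### Correctness of the machine and bounds on its states. -/

section Sweep

variable {V : Type*} [DecidableEq V] {G : SimpleGraph V} [G.LocallyFinite] {n N Q : ℕ}
  {lab : Fin n → ℕ} {C : Config n V Mem}

/-- One pass over the labels for a fixed port. Partial sums never exceed the full sums, which keeps
every intermediate state bounded. -/
theorem sweep (hlab : Function.Injective lab) (hN : ∀ i, lab i ≤ N) (hNQ : N < Q) {i : Fin n}
    {p m : ℕ} (hx : (C.mem i).Below Q) (hp : p < Q) (hm : m < Q)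
    (hS : ∀ k, (C.obs G i).sums p k < Q) {out : Work × Option ℕ}
    (h : nextPort (C.mem i) p m (G.degree (C.pos i)) (C.arr i) ((C.obs G i).sums p) =
        Sum.inr out ∨
      ∃ w, nextPort (C.mem i) p m (G.degree (C.pos i)) (C.arr i) ((C.obs G i).sums p) =
          Sum.inl w ∧
        (sweepRobot N).ComputesWithin (boundedWork Q) (G.degree (C.pos i)) (C.arr i)
          (C.reply lab Mem.idle i) w out) :
    (sweepRobot N).ComputesWithin (boundedWork Q) (G.degree (C.pos i)) (C.arr i)
      (C.reply lab Mem.idle i) (C.mem i, p, m, 0, 0) out := by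
  set term : ℕ → Fin 9 → ℕ := fun q k => (C.reply lab Mem.idle i q).elim 0
    fun z => contribution (C.mem i) p (z.1.1, z.2) k with hterm
  have htotal : ∀ k, ∑ q ∈ Finset.range (N + 1), term q k = (C.obs G i).sums p k :=
    fun k => C.sum_reply hlab hN i fun z => contribution (C.mem i) p z k
  have hmem : ∀ q ≤ N, ((C.mem i, p, m, q, fun k => ∑ q' ∈ Finset.range q, term q' k) : Work) ∈
      boundedWork Q := by
    refine fun q hq => ⟨hx, hp, hm, hq.trans_lt hNQ, fun k => ?_⟩
    refine lt_of_le_of_lt ?_ (hS k)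
    rw [← htotal]
    exact Finset.sum_le_sum_of_subset (Finset.range_mono (by omega))
  have hall : ∀ q ≤ N, (sweepRobot N).ComputesWithin (boundedWork Q) (G.degree (C.pos i)) (C.arr i)
      (C.reply lab Mem.idle i) (C.mem i, p, m, q, fun k => ∑ q' ∈ Finset.range q, term q' k)
      out → (sweepRobot N).ComputesWithin (boundedWork Q) (G.degree (C.pos i)) (C.arr i)
      (C.reply lab Mem.idle i) (C.mem i, p, m, 0, 0) out := by
    intro q
    induction q with
    | zero => exact fun _ h => h
    | succ q ih =>
      refine fun hq hc => ih (by omega) (.step (hmem q (by omega)) ?_ hc)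
      simp only [Finset.sum_range_succ]
      exact if_pos (show q < N from hq)
  have hlast : (sweepRobot N).next
      (C.mem i, p, m, N, fun k => ∑ q' ∈ Finset.range N, term q' k) (G.degree (C.pos i)) (C.arr i)
      (C.reply lab Mem.idle i N) =
      nextPort (C.mem i) p m (G.degree (C.pos i)) (C.arr i) ((C.obs G i).sums p) := by
    have : (C.obs G i).sums p = fun k => ∑ q ∈ Finset.range N, term q k + term N k := by
      funext k
      rw [← htotal, Finset.sum_range_succ]
    rw [this]
    exact if_neg (lt_irrefl N)
  refine hall N le_rfl ?_
  rcases h with h | ⟨w, h, hc⟩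
  · exact .finish (hmem N le_rfl) (hlast.trans h)
  · exact .step (hmem N le_rfl) (hlast.trans h) hc

/-- Induction from the last port downwards. A port is considered only while the prefix sum of
requirements is at most the rank, so the prefix sum inherits the bound on the rank. -/
theorem sweep_ports (hlab : Function.Injective lab) (hN : ∀ i, lab i ≤ N) (hNQ : N < Q) {i : Fin n}
    (hx : (C.mem i).Below Q) (hd : G.degree (C.pos i) < Q)
    (hS : ∀ p k, (C.obs G i).sums p k < Q) {out : Mem × Option ℕ}
    (hout : ∀ p, outcomeOfSums (C.mem i) (G.degree (C.pos i)) (C.arr i) ((C.obs G i).sums p)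
      (C.obs G i).assignedPort = out) {p : ℕ} (hp : p ≤ G.degree (C.pos i))
    (hr : ∑ q ∈ Finset.range p, (C.obs G i).need q ≤ (C.obs G i).rank) :
    (sweepRobot N).ComputesWithin (boundedWork Q) (G.degree (C.pos i)) (C.arr i)
      (C.reply lab Mem.idle i)
      (C.mem i, p, ∑ q ∈ Finset.range p, (C.obs G i).need q, 0, 0) (out.map Mem.idle id) := by
  have hrank : (C.obs G i).rank < Q := by
    rw [← Obs.sums_eight _ 0]
    exact hS 0 8
  induction hp using Nat.decreasingInduction with
  | self =>
    refine sweep hlab hN hNQ hx hd (hr.trans_lt hrank) (hS _) (Or.inl ?_)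
    rw [nextPort, if_neg (lt_irrefl _), ← hout (G.degree (C.pos i)),
      (C.obs G i).assignedPort_eq_none hr]
  | of_succ p hp ih =>
    refine sweep hlab hN hNQ hx (hp.trans hd) (hr.trans_lt hrank) (hS p) ?_
    rw [nextPort, if_pos hp, Obs.sums_eight, Obs.needOfSums_sums, ← Finset.sum_range_succ]
    by_cases hlt : (C.obs G i).rank < ∑ q ∈ Finset.range (p + 1), (C.obs G i).need q
    · left
      rw [if_pos hlt, ← hout p, (C.obs G i).assignedPort_eq_some hp hr hlt]
    · right
      exact ⟨_, if_neg hlt, ih (not_lt.1 hlt)⟩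

theorem sweepRobot_realizes {W : Type*} {e : Work → W} {d : W → Work}
    (hed : ∀ w ∈ boundedWork Q, d (e w) = w) (hlab : Function.Injective lab)
    (hN : ∀ i, lab i ≤ N) (hNQ : N < Q) (hx : ∀ j, (C.mem j).Below Q) {i : Fin n}
    (hd : G.degree (C.pos i) < Q) (hS : ∀ p k, (C.obs G i).sums p k < Q)
    {f : Obs Mem → Mem × Option ℕ}
    (hf : ∀ p, outcomeOfSums (C.mem i) (G.degree (C.pos i)) (C.arr i) ((C.obs G i).sums p)
      (C.obs G i).assignedPort = f (C.obs G i)) :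
    ((sweepRobot N).transfer e d).Realizes G (fun x => e x.idle) lab C i f := by
  have h := (sweep_ports hlab hN hNQ (hx i) hd hS hf (Nat.zero_le _) (by simp)).transfer hed
    (by
      intro q z hz
      rcases C.reply_cases (lab := lab) i q Mem.idle with h | ⟨j, -, -, h⟩
      · rw [h] at hz
        cases hz
      · rw [h, Option.mem_some_iff] at hz
        rw [← hz]
        exact (hx j).idle_mem)
  have hreply : (fun q => (C.reply lab Mem.idle i q).map (Prod.map e id)) =
      C.reply lab (fun x => e x.idle) i := by
    funext q
    rw [Config.reply, Config.reply, Option.map_map]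
    rfl
  rw [hreply] at h
  exact h

theorem sums_le (hr : ∀ j, (C.mem j).numRobotsReqd ≤ n) (i : Fin n) (p : ℕ) (k : Fin 9) :
    (C.obs G i).sums p k ≤ n * n := by
  have hn : 1 ≤ n := (Nat.zero_le _).trans_lt i.isLt
  rw [Obs.sums, C.sum_here]
  refine (Finset.sum_le_card_nsmul _ _ n fun j _ => ?_).trans ?_
  · exact (contribution_le _ _ _ _).trans (max_le hn (hr j))
  · rw [smul_eq_mul]
    exact Nat.mul_le_mul_right n (by simpa using Finset.card_le_univ (α := Fin n) _)

end Sweep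

/-! ### Counting the memory states. -/

section Encoding

instance : Fintype RobotState where
  elems := {RobotState.root, RobotState.explore, RobotState.wait, RobotState.settled}
  complete x := by cases x <;> simp

/-- The memory states of a robot all of whose variables are less than `Q`. -/
abbrev Code (Q : ℕ) : Type :=
  (Fin Q × Fin Q × Option (Fin Q) × RobotState × Fin Q × Fin Q × Bool × Fin Q × Fin Q × Fin Q ×
    Bool) × Fin Q × Fin Q × Fin Q × (Fin 9 → Fin Q)

variable {Q : ℕ}

/-- The code of a memory content. -/
def encode (Q : ℕ) [NeZero Q] (w : Work) : Code Q :=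
  ((Fin.ofNat Q w.1.label, Fin.ofNat Q w.1.portEntered, w.1.parentPtr.map (Fin.ofNat Q),
    w.1.state, Fin.ofNat Q w.1.distFromRoot, Fin.ofNat Q w.1.fullyDispersedPort,
    w.1.fullyDispersed, Fin.ofNat Q w.1.numRobotsReqd, Fin.ofNat Q w.1.lvlCntr,
    Fin.ofNat Q w.1.rndCntr, w.1.stopped),
    Fin.ofNat Q w.2.1, Fin.ofNat Q w.2.2.1, Fin.ofNat Q w.2.2.2.1,
    fun k => Fin.ofNat Q (w.2.2.2.2 k))

/-- The memory content with a given code. -/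
def decode (c : Code Q) : Work :=
  ({ label := c.1.1
     portEntered := c.1.2.1
     parentPtr := c.1.2.2.1.map Fin.val
     state := c.1.2.2.2.1
     distFromRoot := c.1.2.2.2.2.1
     fullyDispersedPort := c.1.2.2.2.2.2.1
     fullyDispersed := c.1.2.2.2.2.2.2.1
     numRobotsReqd := c.1.2.2.2.2.2.2.2.1
     lvlCntr := c.1.2.2.2.2.2.2.2.2.1
     rndCntr := c.1.2.2.2.2.2.2.2.2.2.1
     stopped := c.1.2.2.2.2.2.2.2.2.2.2 },
    c.2.1, c.2.2.1, c.2.2.2.1, fun k => c.2.2.2.2 k)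

theorem decode_encode [NeZero Q] {w : Work} (hw : w ∈ boundedWork Q) :
    decode (encode Q w) = w := by
  obtain ⟨⟨l, pe, pp, s, di, fp, fd, nr, lv, rn, st⟩, p, m, q, S⟩ := w
  obtain ⟨⟨h1, h2, h3, h4, h5, h6, h7, h8⟩, h9, h10, h11, h12⟩ := hw
  dsimp only at *
  have hS : (fun k => S k % Q) = S := funext fun k => Nat.mod_eq_of_lt (h12 k)
  have hpp : (pp.map (Fin.ofNat Q)).map Fin.val = pp := by
    cases pp with
    | none => rfl
    | some q => exact congrArg some (Nat.mod_eq_of_lt (h3 q rfl))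
  simp only [decode, encode, Fin.val_ofNat, Nat.mod_eq_of_lt h1, Nat.mod_eq_of_lt h2,
    Nat.mod_eq_of_lt h4, Nat.mod_eq_of_lt h5, Nat.mod_eq_of_lt h6, Nat.mod_eq_of_lt h7,
    Nat.mod_eq_of_lt h8, Nat.mod_eq_of_lt h9, Nat.mod_eq_of_lt h10, Nat.mod_eq_of_lt h11, hS, hpp]

theorem card_code_le (hQ : 2 ≤ Q) : Fintype.card (Code Q) ≤ Q ^ 25 := by
  have hs : Fintype.card RobotState = 4 := rfl
  simp only [Code, Fintype.card_prod, Fintype.card_fin, Fintype.card_option, Fintype.card_bool,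
    Fintype.card_pi, Finset.prod_const, Finset.card_univ, hs]
  have h1 : Q + 1 ≤ Q * Q := by nlinarith
  have h2 : 4 ≤ Q * Q := by nlinarith
  -- The stored memory costs `Q ^ 13`, as the optional pointer and the state are each charged `Q ^
  -- 2`; the work variables cost `Q ^ 3` and the sums `Q ^ 9`.
  calc _ ≤ (Q * (Q * ((Q * Q) * ((Q * Q) * (Q * (Q * (Q * (Q * (Q * (Q * Q)))))))))) *
        (Q * (Q * (Q * Q ^ 9))) := by gcongr
    _ = Q ^ 25 := by ring

end Encoding

/-! ### The memory bound and the final theorem. -/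

theorem rootedTreeLogN_runsWithBits (c n : ℕ) :
    rootedTreeLogN.RunsWithBits.{u} n (n ^ c) (25 * (c + 3) * (Nat.log 2 n + 1)) := by
  set a := Nat.log 2 n + 1 with ha
  -- As `n < 2 ^ a`, the exponent `c * a` accounts for labels up to `n ^ c`, and the extra `3 * a`
  -- leaves room for sums up to `n * n` and round counters up to `2 * n + 3`.
  set Q := 2 ^ ((c + 3) * a) with hQ
  have hna : n < 2 ^ a := Nat.lt_pow_succ_log_self (by norm_num) n
  have ha2 : 2 ≤ 2 ^ a := by
    calc 2 = 2 ^ 1 := rfl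
      _ ≤ 2 ^ a := Nat.pow_le_pow_right (by norm_num) (by omega)
  have hQ3 : (2 ^ a) ^ c * (2 ^ a) ^ 3 = Q := by
    rw [hQ, ← pow_add, ← pow_mul, mul_comm]
  have hc1 : 1 ≤ (2 ^ a) ^ c := Nat.one_le_pow _ _ (by omega)
  have h8 : (2 ^ a) ^ 3 ≤ Q := by
    rw [← hQ3]
    exact Nat.le_mul_of_pos_left _ hc1
  have hcube : 2 * (2 ^ a * 2 ^ a) ≤ (2 ^ a) ^ 3 := by
    rw [show (2 ^ a) ^ 3 = 2 ^ a * (2 ^ a * 2 ^ a) by ring]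
    exact Nat.mul_le_mul_right _ ha2
  have hsq4 : 2 * 2 ^ a ≤ 2 ^ a * 2 ^ a := Nat.mul_le_mul_right _ ha2
  have hsq : n * n < Q := by
    have h1 : n * n < 2 ^ a * 2 ^ a := Nat.mul_self_lt_mul_self hna
    omega
  have hlin : 2 * n + 3 < Q := by
    omega
  have hlabQ : n ^ c < Q := by
    rw [← hQ3]
    have h1 : n ^ c ≤ (2 ^ a) ^ c := Nat.pow_le_pow_left hna.le c
    have h2 : 2 ≤ (2 ^ a) ^ 3 := by omega
    nlinarith
  have hne : NeZero Q := ⟨by omega⟩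
  refine ⟨Code Q, inferInstance, (sweepRobot (n ^ c)).transfer (encode Q) decode,
    fun x => encode Q x.idle, ?_, ?_⟩
  · refine (card_code_le (by omega)).trans_eq ?_
    rw [hQ, ← pow_mul]
    congr 1
    ring
  · intro V _ _ G _ hG hn P r lab hlab hbd
    have hdeg : ∀ v, G.degree v < Q := fun v => by
      have := G.degree_lt_card_verts v
      omega
    have hN : ∀ i, lab i ≤ n ^ c := fun i => (hbd i).2
    constructor
    · intro i
      refine sweepRobot_realizes (fun _ => decode_encode) hlab hN hlabQ (fun j => ?_) (hdeg _)
        (fun p k => ?_) (fun p => ?_)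
      · exact ⟨(hN j).trans_lt hlabQ, hne.pos, by simp [RobotAlgorithm.freshConfig, rootedTreeLogN],
          hne.pos, hne.pos, hne.pos, hne.pos, hne.pos⟩
      · exact (sums_le (fun j => Nat.zero_le _) i p k).trans_lt hsq
      · exact Obs.outcome_setup ((rootedTreeLogN.freshConfig r lab).obs G i) p rfl _
    · intro t i
      have hinv := run_label_small (P := P) (r := r) hG hn hlab t
      refine sweepRobot_realizes (fun _ => decode_encode) hlab hN hlabQ (fun j => ?_) (hdeg _)
        (fun p k => ?_) (fun p => ?_)
      · obtain ⟨h1, h2⟩ := hinv j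
        refine ⟨?_, ?_, fun q hq => ?_, ?_, ?_, ?_, ?_, ?_⟩
        · rw [h1]
          exact (hN j).trans_lt hlabQ
        · have := h2.entered
          omega
        · have := h2.ptr q hq
          omega
        · have := h2.dist
          omega
        · have := h2.count
          omega
        · have := h2.reqd
          omega
        · have := h2.lvl
          omega
        · have := h2.rnd
          omega
      · exact (sums_le (fun j => (hinv j).2.reqd) i p k).trans_lt hsq
      · exact Obs.outcome_act ((rootedTreeLogN.run P r lab t).obs G i) p (Nat.one_le_iff_ne_zero.1 (hinv i).2.lvl_pos)

/-- Rooted-Tree-LogN runs with `O(log n)` bits of memory per robot, and after `O(D²)` rounds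
dispersion is achieved and all robots have stopped. -/
theorem theorem3 :
    ∃ A : ℕ, ∀ c : ℕ, 1 ≤ c → ∃ B : ℕ, ∀ n : ℕ,
      rootedTreeLogN.RunsWithBits.{u} n (n ^ c) (B * (Nat.log 2 n + 1)) ∧
      ∀ (V : Type u) [Fintype V] [DecidableEq V] (G : SimpleGraph V) [DecidableRel G.Adj],
        G.IsTree → Fintype.card V = n →
        ∀ (P : PortNumbering G) (r : V) (lab : Fin n → ℕ), Function.Injective lab →
          (∀ i, 1 ≤ lab i ∧ lab i ≤ n ^ c) →
          ∀ t : ℕ, A * G.diam ^ 2 ≤ t →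
            (rootedTreeLogN.run P r lab t).Dispersed ∧
            ∀ i, ((rootedTreeLogN.run P r lab t).mem i).stopped = true :=
  ⟨8, fun c _ => ⟨25 * (c + 3), fun n => ⟨rootedTreeLogN_runsWithBits c n,
    fun _ _ _ _ _ hG hn _ _ _ hlab _ _ ht => run_dispersed hG hn hlab ht⟩⟩⟩
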